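/- **Notation.** Fix $n\in\mathbb N$ and $0<\rho<1/1000$. $\mathscr H^d$ is Hausdorff measure on $\mathbb R^n$, and $\mathscr H^d_\infty(S)=\inf\{\sum_i(\operatorname{diam}U_i)^d: S\subseteq\bigcup_i U_i\}$ is Hausdorff content. For $c>0$ and an integer $d>0$, a set $E\subseteq\mathbb R^n$ is *$(c,d)$-lower content regular* if $\mathscr H^d_\infty(E\cap B(x,r))\ge c\,r^d$ for all $x\in E$, $0<r<\operatorname{diam}E$. A set $S$ is *Ahlfors $d$-regular with constant $A>0$* if $r^d/A\le\mathscr H^d(S\cap B(x,r))\le A r^d$ for all $x\in S$, $0<r<\operatorname{diam}S$. A system of *Christ–David cubes* for $E$ consists of a nested sequence $X_k\subseteq X_{k+1}$ ($k\in\mathbb Z$) of maximal $\rho^k$-nets of $E$ and families $\mathscr D_k$ of Borel subsets of $E$ such that: each $\mathscr D_k$ covers $E$; if $j\le k$, $Q\in\mathscr D_j$, $Q'\in\mathscr D_k$ and $Q\cap Q'\ne\emptyset$, then $Q'\subseteq Q$; and, with $\ell(Q)=5\rho^k$, every $Q\in\mathscr D_k$ has a center $\zeta_Q\in X_k$ with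 $E\cap B(\zeta_Q,\ell(Q)/500)\subseteq Q\subseteq B(\zeta_Q,\ell(Q))$, and $X_k=\{\zeta_Q:Q\in\mathscr D_k\}$. A cube is understood together with its generation $k$, and $\mathscr D=\bigcup_k\mathscr D_k$; cubes are ordered by inclusion, the smaller cube being of the same or a later generation. Put $B_Q=B(\zeta_Q,\ell(Q))$, $\lambda B_Q=B(\zeta_Q,\lambda\ell(Q))$, and $\mathrm{Child}(Q)=\{Q'\in\mathscr D_{k+1}:Q'\subseteq Q\}$ for $Q\in\mathscr D_k$. A family $\mathscr T\subseteq\mathscr D$ is a *stopping-time region* with maximal cube $T$ if (i) $T\in\mathscr T$ contains every cube of $\mathscr T$; (ii) if $Q\in\mathscr T$, $R\in\mathscr D$ and $Q\subseteq R\subseteq T$, then $R\in\mathscr T$; (iii) if $Q\in\mathscr T$ and some child of $Q$ is not in $\mathscr T$, then no child of $Q$ is in $\mathscr T$. Dyadic cubes of $\mathbb R^n$ are half-open, $I=\prod_i[m_i2^{-k},(m_i+1)2^{-k})$ with $k,m_i\in\mathbb Z$, $\ell(I)=2^{-k}$, and $\partial_dI$ is the union of the closed $d$-dimensional faces of $I$.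 **Main Lemma.** There is a constant $K=K(n,\rho)>0$ such that for every integer $d>0$ and every $c>0$ there are a constant $K_1=K_1(n,\rho,d,c)>0$ and constants $A(C_0,\tau)$, depending only on $C_0,\tau,n,\rho,d,c$, for which the following holds. Let $E\subseteq\mathbb R^n$ be $(c,d)$-lower content regular with $\operatorname{diam}E\ge1$ (possibly $\infty$), let $\mathscr D$ be a system of Christ–David cubes for $E$ with parameter $\rho$, let $Q_0\in\mathscr D_0$, let $k_0\ge0$ be an integer, and let $\mathscr D(k_0)=\bigcup_{k=0}^{k_0}\{Q\in\mathscr D_k:Q\subseteq Q_0\}$. Then there are $Top\subseteq\mathscr D(k_0)$ and a partition of $\mathscr D(k_0)$ into stopping-time regions $Tree(R)$, $R\in Top$, where $Tree(R)$ has maximal cube $R$, such that: 1. $\sum_{R\in Top}\ell(R)^d\le K_1\,\mathscr H^d(Q_0)$. 2. Let $R\in Top$, let $\mathscr T\subseteq Tree(R)$ be a stopping-time region with maximal cube $T$, let $\mathscr F$ be the set of minimal cubes of $\mathscr T$, and let $d_{\mathscr F}(x)=\inf_{Q\in\mathscr F}(\ell(Q)+\operatorname{dist}(x,Q))$. For all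 $C_0>4$ and $0<\tau<1$ there is a family $\mathscr C$ of pairwise disjoint dyadic cubes such that, with $E(\mathscr T)=\bigcup_{I\in\mathscr C}\partial_dI$: (a) $E(\mathscr T)$ is Ahlfors $d$-regular with constant $A(C_0,\tau)$; (b) $C_0B_T\cap E\subseteq\bigcup_{I\in\mathscr C}I\subseteq 2C_0B_T$; (c) $\operatorname{dist}(x,E(\mathscr T))\le K\tau\,d_{\mathscr F}(x)$ for all $x\in E\cap C_0B_T$; (d) $K^{-1}\tau\inf_{x\in I}d_{\mathscr F}(x)\le\ell(I)\le K\tau\inf_{x\in I}d_{\mathscr F}(x)$ for all $I\in\mathscr C$. In particular no constant depends on $k_0$. -/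

import Mathlib

open scoped ENNReal MeasureTheory

/-- The `d`-dimensional Hausdorff content
`inf { ∑ (diam U_i)^d : S ⊆ ⋃ U_i }` over countable covers by arbitrary sets. -/
noncomputable def hausdorffContent {X : Type*} [MetricSpace X] (d : ℕ) (S : Set X) : ℝ≥0∞ :=
  ⨅ (U : ℕ → Set X) (_ : S ⊆ ⋃ i, U i), ∑' i, Metric.ediam (U i) ^ d

/-- `E` is `(c,d)`-lower content regular: `H^d_∞(E ∩ B(x,r)) ≥ c r^d` for all `x ∈ E` and
`0 < r < diam E`. -/
def IsLowerContentRegular {X : Type*} [MetricSpace X] (c : ℝ) (d : ℕ) (E : Set X) : Prop :=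
  ∀ x ∈ E, ∀ r : ℝ, 0 < r → ENNReal.ofReal r < Metric.ediam E →
    ENNReal.ofReal (c * r ^ d) ≤ hausdorffContent d (E ∩ Metric.ball x r)

/-- `S` is Ahlfors `d`-regular with constant `A > 0`:
`r^d / A ≤ H^d(S ∩ B(x,r)) ≤ A r^d` for all `x ∈ S` and `0 < r < diam S`. -/
def IsAhlforsRegular {X : Type*} [MetricSpace X] [MeasurableSpace X] [BorelSpace X]
    (d : ℕ) (A : ℝ) (S : Set X) : Prop :=
  0 < A ∧ ∀ x ∈ S, ∀ r : ℝ, 0 < r → ENNReal.ofReal r < Metric.ediam S →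
    ENNReal.ofReal (r ^ d / A) ≤ μH[(d : ℝ)] (S ∩ Metric.ball x r) ∧
      μH[(d : ℝ)] (S ∩ Metric.ball x r) ≤ ENNReal.ofReal (A * r ^ d)

/-- `N` is a maximal `δ`-separated subset (a maximal `δ`-net) of `E`. -/
structure IsMaximalNet {X : Type*} [MetricSpace X] (E : Set X) (δ : ℝ) (N : Set X) : Prop where
  subset : N ⊆ E
  separated : ∀ x ∈ N, ∀ y ∈ N, x ≠ y → δ ≤ dist x y
  maximal : ∀ x ∈ E, ∃ y ∈ N, dist x y < δ

/-- A system of Christ–David cubes for `E` with parameter `ρ`: to a nested sequence `net k` of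
maximal `ρ^k`-nets of `E` there belong, for each generation `k`, Borel subsets `cubes k` of `E`
that cover `E`, are nested across generations (and disjoint within a generation), and satisfy
`E ∩ B(ζ_Q, ℓ(Q)/500) ⊆ Q ⊆ E ∩ B(ζ_Q, ℓ(Q))`, where `ℓ(Q) = 5 ρ^k` and the centers `ζ_Q` of the
cubes of generation `k` are exactly the points of `net k`. -/
structure ChristDavidCubes {X : Type*} [MetricSpace X] [MeasurableSpace X] [BorelSpace X]
    (E : Set X) (ρ : ℝ) where
  net : ℤ → Set X
  net_maximal : ∀ k, IsMaximalNet E (ρ ^ k) (net k)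
  net_nested : ∀ k, net k ⊆ net (k + 1)
  cubes : ℤ → Set (Set X)
  borel : ∀ k, ∀ Q ∈ cubes k, ∃ B : Set X, MeasurableSet B ∧ Q = E ∩ B
  cover : ∀ k, ⋃₀ cubes k = E
  nested : ∀ j k, j ≤ k → ∀ Q ∈ cubes j, ∀ Q' ∈ cubes k, (Q ∩ Q').Nonempty → Q' ⊆ Q
  center : ℤ → Set X → X
  center_image : ∀ k, center k '' cubes k = net k
  inner_ball : ∀ k, ∀ Q ∈ cubes k, E ∩ Metric.ball (center k Q) (1 / 500 * (5 * ρ ^ k)) ⊆ Q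
  outer_ball : ∀ k, ∀ Q ∈ cubes k, Q ⊆ E ∩ Metric.ball (center k Q) (5 * ρ ^ k)

namespace ChristDavidCubes

section

variable {X : Type*} [MetricSpace X] [MeasurableSpace X] [BorelSpace X] {E : Set X} {ρ : ℝ}

/-- A cube of the system together with its generation (the same set may be a cube of several
generations; the generation determines `ℓ(Q)`). -/
@[ext]
structure Cube (D : ChristDavidCubes E ρ) where
  gen : ℤ
  carrier : Set X
  mem : carrier ∈ D.cubes gen

variable {D : ChristDavidCubes E ρ}

/-- `ℓ(Q) = 5 ρ^k`. -/
noncomputable def Cube.side (Q : D.Cube) : ℝ := 5 * ρ ^ Q.gen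

/-- The ball `λ B_Q`, where `B_Q = B(ζ_Q, ℓ(Q))`. -/
noncomputable def Cube.dilatedBall (Q : D.Cube) (lam : ℝ) : Set X :=
  Metric.ball (D.center Q.gen Q.carrier) (lam * Q.side)

/-- `Q ≤ R`: `Q` is a subcube of `R`, of the same or a later generation. -/
instance : PartialOrder D.Cube where
  le Q R := R.gen ≤ Q.gen ∧ Q.carrier ⊆ R.carrier
  le_refl Q := ⟨le_refl _, subset_rfl⟩
  le_trans _ _ _ h h' := ⟨h'.1.trans h.1, h.2.trans h'.2⟩
  le_antisymm _ _ h h' := Cube.ext (le_antisymm h'.1 h.1) (Set.Subset.antisymm h.2 h'.2)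

/-- The children of `Q`: the cubes of the next generation contained in `Q`. -/
def Cube.children (Q : D.Cube) : Set D.Cube :=
  {Q' | Q'.gen = Q.gen + 1 ∧ Q'.carrier ⊆ Q.carrier}

/-- `T` is a stopping-time region (tree) with maximal cube `T₀`. -/
structure IsStoppingTimeRegion (T : Set D.Cube) (T₀ : D.Cube) : Prop where
  greatest : IsGreatest T T₀
  coherent : ∀ Q ∈ T, ∀ R : D.Cube, Q ≤ R → R ≤ T₀ → R ∈ T
  children : ∀ Q ∈ T, (∃ Q' ∈ Q.children, Q' ∉ T) → ∀ Q'' ∈ Q.children, Q'' ∉ T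

/-- The minimal cubes of a family of cubes. -/
def minimalCubes (T : Set D.Cube) : Set D.Cube := {Q | Minimal (· ∈ T) Q}

/-- `d_F(x) = inf_{Q ∈ F} (ℓ(Q) + dist(x, Q))`. -/
noncomputable def distFun (F : Set D.Cube) (x : X) : ℝ :=
  ⨅ Q : F, ((Q : D.Cube).side + Metric.infDist x (Q : D.Cube).carrier)

/-- The cubes contained in `Q₀` of generations `0, …, k₀`. -/
def upTo (Q₀ : D.Cube) (k₀ : ℕ) : Set D.Cube :=
  {Q | 0 ≤ Q.gen ∧ Q.gen ≤ k₀ ∧ Q.carrier ⊆ Q₀.carrier}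

end

end ChristDavidCubes

/-- The (half-open) dyadic cube `∏ᵢ [mᵢ 2⁻ᵏ, (mᵢ + 1) 2⁻ᵏ)` of `ℝⁿ`, given by `k` and `m`. -/
structure DyadicCube (n : ℕ) where
  scale : ℤ
  index : Fin n → ℤ

namespace DyadicCube

/-- The side length `ℓ(I) = 2⁻ᵏ`. -/
noncomputable def side {n : ℕ} (I : DyadicCube n) : ℝ := (2 : ℝ) ^ (-I.scale)

/-- The points of the half-open cube. -/
def carrier {n : ℕ} (I : DyadicCube n) : Set (EuclideanSpace ℝ (Fin n)) :=
  {x | ∀ i, x i ∈ Set.Ico (I.index i * I.side) ((I.index i + 1) * I.side)}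

/-- The `d`-dimensional skeleton `∂_d I`: the union of the closed `d`-dimensional faces. A face
is given by the set `s` of its `d` free coordinates and a choice of an endpoint in every other
coordinate. -/
def skeleton {n : ℕ} (d : ℕ) (I : DyadicCube n) : Set (EuclideanSpace ℝ (Fin n)) :=
  {x | ∃ s : Finset (Fin n), s.card = d ∧
    (∀ i ∈ s, x i ∈ Set.Icc (I.index i * I.side) ((I.index i + 1) * I.side)) ∧
    ∀ i ∉ s, x i = I.index i * I.side ∨ x i = (I.index i + 1) * I.side}

end DyadicCube

/-! Let `h Q` be the Hausdorff content of a cube. Lower content regularity makes it comparable to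
ℓ(Q)^d, and subadditivity makes the ratio of the children's total to `h` of the parent at least 1.
Dividing `h Q` by the product of these ratios over the proper ancestors of `Q` (`ratioProd`) gives
an exactly additive weight. The product grows downwards and agrees on siblings, so cutting the cubes
by its binary logarithm produces stopping-time regions. On one of them `ratioProd` varies by a
factor less than 2, so the additive weight, rescaled, is comparable to ℓ^d
(`IsSubadditiveWeight.isRegularWeight`). Above a cube of generation `k₀` there is at most one top
cube per level; a geometric sum bounds the total of `h` over the top cubes by four times its total
over generation `k₀`, hence by 4 H^d(Q₀) (`exists_corona`).

For a region T the family 𝒞 consists of the maximal dyadic cubes with side at most λ d_F on the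
whole cube, λ = τ/(8(n+1)), through the points of E ∩ C₀B_T (`exists_whitney`). Since d_F is
1-Lipschitz, (b), (c) and (d) follow from this choice, and Ahlfors regularity is the real content of
(a).

Upper bound: each Whitney cube is charged to a cube Q of T of comparable size and position
(`exists_charge`), and ℓ^d must be packed over the charged cubes, which may be nested in many
generations. Such a Q sees a point y of E at its own scale with d_F(y) ≥ ℓ(Q). For Q below P, either
y lies outside P, or y lies in a minimal cube Q₁ at least as large as Q; then Q is Q₁ itself, or it
is near the complement of one of boundedly many cubes of the generation of Q₁. So it suffices to
pack the cubes Q below P near the complement of P at their own scale (`exists_boundary_packing`).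
Around the center of such a Q there is a cube of T, boundedly many generations below, that meets no
cube of the same kind m or more generations below Q: otherwise the point outside P would be so close
to the center of Q as to belong to Q. Along a residue class of generations mod m these holes are
disjoint, and their regular weights add up to at most that of P. No thin-boundary property of the
cubes is needed.

Lower bound: in a ball that is small compared with its Whitney cube, the skeleton of that cube
suffices. Otherwise a ball of radius comparable to r about the center of a minimal cube has content
at least a multiple of r^d, and the Whitney cubes covering it have disjoint half-open d-faces inside
B(x, r). -/

namespace ChristDavidCubes

/-! ### Order and metric geometry of cubes -/

section Basics

variable {X : Type*} [MetricSpace X] [MeasurableSpace X] [BorelSpace X] {E : Set X} {ρ : ℝ}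
  {D : ChristDavidCubes E ρ}

/-- The center of a cube. -/
noncomputable def Cube.ctr (Q : D.Cube) : X := D.center Q.gen Q.carrier

lemma Cube.side_pos (hρ : 0 < ρ) (Q : D.Cube) : 0 < Q.side := by
  unfold Cube.side; positivity

lemma Cube.carrier_subset (Q : D.Cube) : Q.carrier ⊆ E :=
  fun _ hx => (D.outer_ball _ _ Q.mem hx).1

lemma Cube.ctr_mem_net (Q : D.Cube) : Q.ctr ∈ D.net Q.gen := by
  rw [← D.center_image Q.gen]; exact ⟨_, Q.mem, rfl⟩

lemma Cube.ctr_mem_ambient (Q : D.Cube) : Q.ctr ∈ E :=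
  (D.net_maximal _).subset Q.ctr_mem_net

lemma Cube.mem_of_dist_lt (Q : D.Cube) {x : X} (hx : x ∈ E) (h : dist x Q.ctr < Q.side / 500) :
    x ∈ Q.carrier := by
  refine D.inner_ball _ _ Q.mem ⟨hx, ?_⟩
  rw [Metric.mem_ball]
  unfold Cube.side at h
  calc _ < _ := h
    _ = _ := by ring

lemma Cube.ctr_mem (hρ : 0 < ρ) (Q : D.Cube) : Q.ctr ∈ Q.carrier := by
  refine Q.mem_of_dist_lt Q.ctr_mem_ambient ?_
  have := Q.side_pos hρ
  rw [dist_self]; positivity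

lemma Cube.dist_ctr_lt (Q : D.Cube) {x : X} (hx : x ∈ Q.carrier) : dist x Q.ctr < Q.side :=
  (D.outer_ball _ _ Q.mem hx).2

lemma Cube.le_of_inter {Q R : D.Cube} (hg : R.gen ≤ Q.gen)
    (h : (R.carrier ∩ Q.carrier).Nonempty) : Q ≤ R :=
  ⟨hg, D.nested _ _ hg _ R.mem _ Q.mem h⟩

lemma Cube.eq_of_inter {Q R : D.Cube} (hg : R.gen = Q.gen)
    (h : (R.carrier ∩ Q.carrier).Nonempty) : Q = R :=
  le_antisymm (Cube.le_of_inter hg.le h) (Cube.le_of_inter hg.ge (by rwa [Set.inter_comm]))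

lemma Cube.le_of_mem {Q R : D.Cube} (hg : R.gen ≤ Q.gen) {x : X} (hR : x ∈ R.carrier)
    (hQ : x ∈ Q.carrier) : Q ≤ R := Cube.le_of_inter hg ⟨x, hR, hQ⟩

lemma Cube.eq_of_mem {Q R : D.Cube} (hg : R.gen = Q.gen) {x : X} (hR : x ∈ R.carrier)
    (hQ : x ∈ Q.carrier) : Q = R := Cube.eq_of_inter hg ⟨x, hR, hQ⟩

lemma Cube.disjoint_of_gen_eq {Q R : D.Cube} (hg : R.gen = Q.gen) (hne : Q ≠ R) :
    Disjoint Q.carrier R.carrier := by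
  rw [Set.disjoint_left]
  exact fun x hQ hR => hne (Cube.eq_of_mem hg hR hQ)

lemma exists_cube_of_mem (D : ChristDavidCubes E ρ) (k : ℤ) {x : X} (hx : x ∈ E) :
    ∃ Q : D.Cube, Q.gen = k ∧ x ∈ Q.carrier := by
  rw [← D.cover k] at hx
  obtain ⟨S, hS, hxS⟩ := hx
  exact ⟨⟨k, S, hS⟩, rfl, hxS⟩

lemma Cube.exists_le_of_mem (Q : D.Cube) {k : ℤ} (hk : Q.gen ≤ k) {x : X} (hx : x ∈ Q.carrier) :
    ∃ R : D.Cube, R.gen = k ∧ x ∈ R.carrier ∧ R ≤ Q := by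
  obtain ⟨R, hR, hxR⟩ := D.exists_cube_of_mem k (Q.carrier_subset hx)
  exact ⟨R, hR, hxR, Cube.le_of_mem (hR ▸ hk) hx hxR⟩

lemma Cube.exists_ge (hρ : 0 < ρ) (Q : D.Cube) {k : ℤ} (hk : k ≤ Q.gen) :
    ∃ R : D.Cube, R.gen = k ∧ Q ≤ R := by
  obtain ⟨R, hR, hxR⟩ := D.exists_cube_of_mem k Q.ctr_mem_ambient
  exact ⟨R, hR, Cube.le_of_mem (hR ▸ hk) hxR (Q.ctr_mem hρ)⟩

/-- Two cubes above the same cube are comparable. -/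
lemma Cube.le_of_le_of_le (hρ : 0 < ρ) {Q R S : D.Cube} (hR : Q ≤ R) (hS : Q ≤ S)
    (hg : S.gen ≤ R.gen) : R ≤ S :=
  Cube.le_of_mem hg (hS.2 (Q.ctr_mem hρ)) (hR.2 (Q.ctr_mem hρ))

lemma Cube.eq_of_le_of_le (hρ : 0 < ρ) {Q R S : D.Cube} (hR : Q ≤ R) (hS : Q ≤ S)
    (hg : S.gen = R.gen) : R = S :=
  Cube.eq_of_mem hg (hS.2 (Q.ctr_mem hρ)) (hR.2 (Q.ctr_mem hρ))

lemma Cube.eq_of_le_of_gen_eq (hρ : 0 < ρ) {Q R : D.Cube} (h : Q ≤ R) (hg : R.gen = Q.gen) :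
    Q = R :=
  Cube.eq_of_le_of_le hρ le_rfl h hg

lemma Cube.gen_lt_of_lt (hρ : 0 < ρ) {Q R : D.Cube} (h : Q < R) : R.gen < Q.gen :=
  lt_of_le_of_ne h.le.1 fun hg => h.ne (Cube.eq_of_le_of_gen_eq hρ h.le hg)

lemma Cube.side_le_side (hρ : 0 < ρ) (hρ1 : ρ ≤ 1) {Q R : D.Cube} (h : R.gen ≤ Q.gen) :
    Q.side ≤ R.side := by
  unfold Cube.side
  have := zpow_le_zpow_right_of_le_one₀ hρ hρ1 h
  linarith

lemma Cube.gen_le_of_side_le (hρ : 0 < ρ) (hρ1 : ρ < 1) {Q R : D.Cube} (h : Q.side ≤ R.side) :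
    R.gen ≤ Q.gen := by
  unfold Cube.side at h
  have h' : ρ ^ Q.gen ≤ ρ ^ R.gen := by linarith
  exact (zpow_le_zpow_iff_right_of_lt_one₀ hρ hρ1).1 h'

lemma Cube.side_eq_mul (hρ : 0 < ρ) {Q R : D.Cube} {m : ℕ} (h : Q.gen = R.gen + m) :
    Q.side = ρ ^ m * R.side := by
  unfold Cube.side
  rw [h, zpow_add₀ hρ.ne', zpow_natCast]; ring

lemma Cube.side_eq_of_gen_eq {Q R : D.Cube} (h : Q.gen = R.gen) : Q.side = R.side := by
  unfold Cube.side; rw [h]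

/-- A proper subcube lies in a child. -/
lemma Cube.exists_child_ge (hρ : 0 < ρ) {Q R : D.Cube} (h : Q < R) : ∃ P ∈ R.children, Q ≤ P := by
  have hg := Cube.gen_lt_of_lt hρ h
  obtain ⟨P, hP, hQP⟩ := Q.exists_ge hρ (k := R.gen + 1) (by omega)
  exact ⟨P, ⟨hP, (Cube.le_of_le_of_le hρ hQP h.le (by omega)).2⟩, hQP⟩

lemma Cube.lt_of_mem_children {Q R : D.Cube} (h : Q ∈ R.children) : Q < R :=
  lt_of_le_of_ne ⟨by have := h.1; omega, h.2⟩ fun he => by have := h.1; rw [he] at this; omega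

lemma Cube.exists_mem_children {R : D.Cube} {x : X} (hx : x ∈ R.carrier) :
    ∃ P ∈ R.children, x ∈ P.carrier := by
  obtain ⟨P, hP, hxP, hle⟩ := R.exists_le_of_mem (k := R.gen + 1) (by omega) hx
  exact ⟨P, ⟨hP, hle.2⟩, hxP⟩

lemma Cube.dist_ctr_lt_of_le (hρ : 0 < ρ) {Q R : D.Cube} (h : Q ≤ R) :
    dist Q.ctr R.ctr < R.side :=
  R.dist_ctr_lt (h.2 (Q.ctr_mem hρ))

lemma Cube.infDist_le (hρ : 0 < ρ) (Q : D.Cube) (x : X) :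
    Metric.infDist x Q.carrier ≤ dist x Q.ctr :=
  Metric.infDist_le_dist_of_mem (Q.ctr_mem hρ)

lemma Cube.dist_ctr_le_infDist (hρ : 0 < ρ) (Q : D.Cube) (x : X) :
    dist x Q.ctr ≤ Metric.infDist x Q.carrier + Q.side := by
  rw [← sub_le_iff_le_add, Metric.le_infDist ⟨_, Q.ctr_mem hρ⟩]
  intro y hy
  have h1 := Q.dist_ctr_lt hy
  have h2 := dist_triangle x y Q.ctr
  linarith

end Basics

/-! ### Stopping-time regions, minimal cubes and the distance function -/

section Regions

variable {X : Type*} [MetricSpace X] [MeasurableSpace X] [BorelSpace X] {E : Set X} {ρ : ℝ}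
  {D : ChristDavidCubes E ρ} {T : Set D.Cube} {T₀ : D.Cube}

/-- In a region, a cube with a proper subcube in the region has all its children there. -/
lemma IsStoppingTimeRegion.children_subset (hT : IsStoppingTimeRegion T T₀) (hρ : 0 < ρ)
    {Q R : D.Cube} (hR : R ∈ T) (hQ : Q ∈ T) (hlt : Q < R) : R.children ⊆ T := by
  obtain ⟨P, hP, hQP⟩ := Cube.exists_child_ge hρ hlt
  have hPT : P ∈ T := hT.coherent Q hQ P hQP
    ((Cube.lt_of_mem_children hP).le.trans (hT.greatest.2 hR))
  intro P' hP'
  by_contra hcon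
  exact hT.children R hR ⟨P', hP', hcon⟩ P hP hPT

/-- Below every cube of a finite region, containing a prescribed point, there is a minimal one. -/
lemma IsStoppingTimeRegion.exists_minimal (hT : IsStoppingTimeRegion T T₀) (hfin : T.Finite)
    (hρ : 0 < ρ) {R : D.Cube} (hR : R ∈ T) {x : X} (hx : x ∈ R.carrier) :
    ∃ Q ∈ minimalCubes T, x ∈ Q.carrier ∧ Q ≤ R := by
  -- The deepest cube of the region through `x` is minimal: otherwise all its children are in the
  -- region, among them one through `x`.
  obtain ⟨Q, ⟨hQT, hxQ, hQR⟩, hmax⟩ :=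
    (hfin.subset (t := {Q | Q ∈ T ∧ x ∈ Q.carrier ∧ Q ≤ R}) fun Q hQ => hQ.1).exists_maximalFor
      (fun Q => Q.gen) _ ⟨R, hR, hx, le_rfl⟩
  refine ⟨Q, ⟨hQT, fun Q' hQ' hle => ?_⟩, hxQ, hQR⟩
  by_contra hcon
  obtain ⟨P, hP, hxP⟩ := Cube.exists_mem_children hxQ
  have hPT := hT.children_subset hρ hQT hQ' (lt_of_le_not_ge hle hcon) hP
  have h1 : P.gen ≤ Q.gen :=
    hmax ⟨hPT, hxP, (Cube.lt_of_mem_children hP).le.trans hQR⟩ (by show Q.gen ≤ P.gen; rw [hP.1]; omega)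
  rw [hP.1] at h1; omega

lemma IsStoppingTimeRegion.minimalCubes_nonempty (hT : IsStoppingTimeRegion T T₀)
    (hfin : T.Finite) (hρ : 0 < ρ) : (minimalCubes T).Nonempty := by
  obtain ⟨Q, hQ, -⟩ := hT.exists_minimal hfin hρ hT.greatest.1 (T₀.ctr_mem hρ)
  exact ⟨Q, hQ⟩

lemma minimalCubes_subset : minimalCubes T ⊆ T := fun _ hQ => hQ.1

lemma eq_of_le_minimal {Q R : D.Cube} (hQ : Q ∈ T) (hR : R ∈ minimalCubes T) (h : Q ≤ R) :
    Q = R := le_antisymm h (hR.2 hQ h)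

/-- Distinct minimal cubes are disjoint. -/
lemma disjoint_of_minimal {Q R : D.Cube} (hQ : Q ∈ minimalCubes T) (hR : R ∈ minimalCubes T)
    (hne : Q ≠ R) : Disjoint Q.carrier R.carrier := by
  rw [Set.disjoint_left]
  intro x hxQ hxR
  rcases le_total Q.gen R.gen with h | h
  · exact hne (eq_of_le_minimal hR.1 hQ (Cube.le_of_mem h hxQ hxR)).symm
  · exact hne (eq_of_le_minimal hQ.1 hR (Cube.le_of_mem h hxR hxQ))

section DistFun

variable {F : Set D.Cube}

lemma distFun_le (hρ : 0 < ρ) {Q : D.Cube} (hQ : Q ∈ F) (x : X) :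
    distFun F x ≤ Q.side + Metric.infDist x Q.carrier := by
  refine ciInf_le (f := fun Q : F => (Q : D.Cube).side + Metric.infDist x (Q : D.Cube).carrier)
    ⟨0, ?_⟩ ⟨Q, hQ⟩
  rintro _ ⟨R, rfl⟩
  exact add_nonneg (R.1.side_pos hρ).le Metric.infDist_nonneg

lemma exists_distFun_eq (hfin : F.Finite) (hne : F.Nonempty) (x : X) :
    ∃ Q ∈ F, Q.side + Metric.infDist x Q.carrier = distFun F x := by
  have := hfin.to_subtype
  have := hne.to_subtype
  obtain ⟨Q, hQ⟩ := exists_eq_ciInf_of_finite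
    (f := fun Q : F => (Q : D.Cube).side + Metric.infDist x (Q : D.Cube).carrier)
  exact ⟨Q, Q.2, hQ⟩

lemma distFun_le_add_dist (hρ : 0 < ρ) (hfin : F.Finite) (hne : F.Nonempty) (x y : X) :
    distFun F x ≤ distFun F y + dist x y := by
  obtain ⟨Q, hQ, hQe⟩ := exists_distFun_eq hfin hne y
  have h1 := distFun_le hρ hQ x
  have h2 : Metric.infDist x Q.carrier ≤ Metric.infDist y Q.carrier + dist x y :=
    Metric.infDist_le_infDist_add_dist
  linarith

/-- The smallest side length in the finite family is such a bound. It only guarantees that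
admissible dyadic cubes exist; it enters no constant. -/
lemma exists_pos_le_distFun (hρ : 0 < ρ) (hfin : F.Finite) (hne : F.Nonempty) :
    ∃ ε > 0, ∀ x : X, ε ≤ distFun F x := by
  obtain ⟨R, hR, hmin⟩ := hfin.exists_minimalFor (fun Q => Q.side) _ hne
  refine ⟨R.side, R.side_pos hρ, fun x => ?_⟩
  obtain ⟨Q, hQ, hQe⟩ := exists_distFun_eq hfin hne x
  have h1 : R.side ≤ Q.side := by
    rcases le_total R.side Q.side with h | h
    · exact h
    · exact hmin hQ h
  have h2 : 0 ≤ Metric.infDist x Q.carrier := Metric.infDist_nonneg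
  linarith

end DistFun

end Regions

end ChristDavidCubes

/-! ### Counting separated points and cubes of one generation -/

section Counting

lemma exists_card_le_integer_box (n : ℕ) (L : ℝ) : ∃ N : ℕ, ∀ (a : Fin n → ℝ)
    (Z : Set (Fin n → ℤ)), (∀ m ∈ Z, ∀ i, a i ≤ m i ∧ (m i : ℝ) ≤ a i + L) →
    Z.Finite ∧ Z.ncard ≤ N := by
  refine ⟨(⌊L⌋ + 1).toNat ^ n, fun a Z hZ => ?_⟩
  have hsub : Z ⊆ ↑(Fintype.piFinset fun i => Finset.Icc ⌈a i⌉ ⌊a i + L⌋) := by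
    intro m hm
    simp only [Finset.mem_coe, Fintype.mem_piFinset, Finset.mem_Icc]
    exact fun i => ⟨Int.ceil_le.2 (hZ m hm i).1, Int.le_floor.2 (hZ m hm i).2⟩
  refine ⟨(Finset.finite_toSet _).subset hsub, ?_⟩
  refine (Set.ncard_le_ncard hsub (Finset.finite_toSet _)).trans ?_
  rw [Set.ncard_coe_finset, Fintype.card_piFinset]
  refine (Finset.prod_le_pow_card _ _ (⌊L⌋ + 1).toNat fun i _ => ?_).trans (by simp)
  rw [Int.card_Icc]
  refine Int.toNat_le_toNat ?_
  have h1 : (⌊a i + L⌋ : ℝ) - ⌈a i⌉ ≤ L := by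
    have := Int.floor_le (a i + L)
    have := Int.le_ceil (a i)
    linarith
  have h2 : ⌊a i + L⌋ - ⌈a i⌉ ≤ ⌊L⌋ := Int.le_floor.2 (by push_cast; exact h1)
  omega

lemma EuclideanSpace.dist_le_sum_abs {n : ℕ} (x y : EuclideanSpace ℝ (Fin n)) :
    dist x y ≤ ∑ i, |x i - y i| := by
  rw [EuclideanSpace.dist_eq]
  refine (Real.sqrt_le_left (by positivity)).2 ?_
  calc ∑ i, dist (x i) (y i) ^ 2 = ∑ i, |x i - y i| ^ 2 := by simp [Real.dist_eq]
    _ ≤ (∑ i, |x i - y i|) ^ 2 := Finset.sum_sq_le_sq_sum_of_nonneg fun i _ => abs_nonneg _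

lemma EuclideanSpace.dist_le_mul {n : ℕ} {x y : EuclideanSpace ℝ (Fin n)} {r : ℝ}
    (h : ∀ i, |x i - y i| ≤ r) : dist x y ≤ n * r := by
  refine (EuclideanSpace.dist_le_sum_abs x y).trans ?_
  simpa using Finset.sum_le_sum fun i (_ : i ∈ Finset.univ) => h i

lemma EuclideanSpace.abs_sub_le_dist {n : ℕ} (x y : EuclideanSpace ℝ (Fin n)) (i : Fin n) :
    |x i - y i| ≤ dist x y := by
  rw [dist_eq_norm]
  exact PiLp.norm_apply_le (x - y) i

/-- Separated sets in a ball have boundedly many points. -/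
lemma exists_card_le_of_separated (n : ℕ) (L : ℝ) : ∃ N : ℕ, ∀ δ : ℝ, 0 < δ →
    ∀ (x : EuclideanSpace ℝ (Fin n)) (Z : Set (EuclideanSpace ℝ (Fin n))),
      (∀ z ∈ Z, dist z x ≤ L * δ) → (∀ z ∈ Z, ∀ w ∈ Z, z ≠ w → δ ≤ dist z w) →
      Z.Finite ∧ Z.ncard ≤ N := by
  obtain ⟨N, hN⟩ := exists_card_le_integer_box n (2 * L * (n + 1) + 1)
  refine ⟨N, fun δ hδ x Z hZ hsep => ?_⟩
  -- In a grid of mesh δ/(n+1), two points of one cell are at distance at most nδ/(n+1) < δ, so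
  -- rounding is injective on `Z`.
  set s : ℝ := (n + 1) / δ with hs
  have hs0 : 0 < s := by positivity
  have hsδ : s * δ = n + 1 := by rw [hs]; field_simp
  let f : EuclideanSpace ℝ (Fin n) → Fin n → ℤ := fun z i => ⌊s * z i⌋
  have hinj : Set.InjOn f Z := by
    intro z hz w hw hzw
    by_contra hne
    have h1 := hsep z hz w hw hne
    have h2 : dist z w ≤ n * s⁻¹ := by
      refine EuclideanSpace.dist_le_mul fun i => ?_
      have h3 : ⌊s * z i⌋ = ⌊s * w i⌋ := congrFun hzw i
      have h4 := Int.abs_sub_lt_one_of_floor_eq_floor h3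
      rw [← mul_sub, abs_mul, abs_of_pos hs0] at h4
      rw [← one_div, le_div_iff₀ hs0]
      linarith
    have h5 : s * δ ≤ s * (n * s⁻¹) := by gcongr; linarith
    rw [hsδ] at h5
    have h6 : s * (n * s⁻¹) = n := by field_simp
    linarith
  have := hN (fun i => s * x i - L * (n + 1) - 1) (f '' Z) (by
    rintro _ ⟨z, hz, rfl⟩ i
    have h1 := (EuclideanSpace.abs_sub_le_dist z x i).trans (hZ z hz)
    have h2 : |s * z i - s * x i| ≤ L * (n + 1) := by
      rw [← mul_sub, abs_mul, abs_of_pos hs0, ← hsδ]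
      calc s * |z i - x i| ≤ s * (L * δ) := by gcongr
        _ = _ := by ring
    obtain ⟨h3, h4⟩ := abs_le.1 h2
    have h5 := Int.floor_le (s * z i)
    have h6 := Int.lt_floor_add_one (s * z i)
    constructor <;> simp only [f] <;> linarith)
  exact ⟨this.1.of_finite_image hinj, by rw [← hinj.ncard_image]; exact this.2⟩

namespace ChristDavidCubes

/-- The cubes of one generation centered near a point are boundedly many. -/
lemma exists_card_le_of_gen (n : ℕ) (L : ℝ) : ∃ N : ℕ, ∀ (ρ : ℝ), 0 < ρ →
    ∀ (E : Set (EuclideanSpace ℝ (Fin n))) (D : ChristDavidCubes E ρ)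
      (x : EuclideanSpace ℝ (Fin n)) (k : ℤ) (Z : Set D.Cube),
      (∀ Q ∈ Z, Q.gen = k ∧ dist Q.ctr x ≤ L * Q.side) → Z.Finite ∧ Z.ncard ≤ N := by
  obtain ⟨N, hN⟩ := exists_card_le_of_separated n (L * 5)
  refine ⟨N, fun ρ hρ E D x k Z hZ => ?_⟩
  have hinj : Set.InjOn Cube.ctr Z := by
    intro Q hQ R hR h
    exact Cube.eq_of_mem ((hZ R hR).1.trans (hZ Q hQ).1.symm) (R.ctr_mem hρ) (h ▸ Q.ctr_mem hρ)
  have := hN (ρ ^ k) (by positivity) x (Cube.ctr '' Z) (by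
    rintro _ ⟨Q, hQ, rfl⟩
    have := (hZ Q hQ).2
    unfold Cube.side at this
    rw [(hZ Q hQ).1] at this
    linarith) (by
    rintro _ ⟨Q, hQ, rfl⟩ _ ⟨R, hR, rfl⟩ hne
    refine (D.net_maximal k).separated _ ?_ _ ?_ hne
    · rw [← (hZ Q hQ).1]; exact Q.ctr_mem_net
    · rw [← (hZ R hR).1]; exact R.ctr_mem_net)
  exact ⟨this.1.of_finite_image hinj, by rw [← hinj.ncard_image]; exact this.2⟩

lemma finite_upTo {n : ℕ} {ρ : ℝ} (hρ : 0 < ρ) {E : Set (EuclideanSpace ℝ (Fin n))}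
    {D : ChristDavidCubes E ρ} (Q₀ : D.Cube) (k₀ : ℕ) : (upTo Q₀ k₀).Finite := by
  have h : upTo Q₀ k₀ ⊆ ⋃ k ∈ Set.Icc (0 : ℤ) k₀, {Q : D.Cube | Q.gen = k ∧ Q.carrier ⊆ Q₀.carrier} := by
    rintro Q ⟨h0, h1, h2⟩
    simp only [Set.mem_iUnion]
    exact ⟨Q.gen, ⟨h0, h1⟩, rfl, h2⟩
  refine Set.Finite.subset (Set.Finite.biUnion (Set.finite_Icc _ _) fun k _ => ?_) h
  have hk : (0 : ℝ) < 5 * ρ ^ k := by positivity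
  obtain ⟨N, hN⟩ := exists_card_le_of_gen n (Q₀.side / (5 * ρ ^ k))
  refine (hN ρ hρ E D Q₀.ctr k _ ?_).1
  rintro Q ⟨hQ, hsub⟩
  refine ⟨hQ, ?_⟩
  have h1 := Q₀.dist_ctr_lt (hsub (Q.ctr_mem hρ))
  have h2 : Q.side = 5 * ρ ^ k := by rw [Cube.side, hQ]
  rw [h2, div_mul_cancel₀ _ hk.ne']
  exact h1.le

end ChristDavidCubes

end Counting

/-! ### Hausdorff content -/

section Content

variable {X : Type*} [MetricSpace X]

/-- Gives access to monotonicity and subadditivity of outer measures. Positivity of `d` makes the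
empty set cost 0. -/
lemma hausdorffContent_eq_ofFunction {d : ℕ} (hd : 0 < d) (S : Set X) :
    hausdorffContent d S = MeasureTheory.OuterMeasure.ofFunction
      (fun U : Set X => Metric.ediam U ^ d) (by simp [hd.ne']) S := by
  rw [MeasureTheory.OuterMeasure.ofFunction_apply]; rfl

lemma hausdorffContent_mono {d : ℕ} (hd : 0 < d) {S S' : Set X} (h : S ⊆ S') :
    hausdorffContent d S ≤ hausdorffContent d S' := by
  rw [hausdorffContent_eq_ofFunction hd, hausdorffContent_eq_ofFunction hd]
  exact MeasureTheory.measure_mono h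

lemma hausdorffContent_le_ediam_pow {d : ℕ} (hd : 0 < d) (S : Set X) :
    hausdorffContent d S ≤ Metric.ediam S ^ d := by
  rw [hausdorffContent_eq_ofFunction hd]
  exact MeasureTheory.OuterMeasure.ofFunction_le _

lemma hausdorffContent_le_sum {d : ℕ} (hd : 0 < d) {ι : Type*} (s : Finset ι) (f : ι → Set X)
    {S : Set X} (h : S ⊆ ⋃ i ∈ s, f i) :
    hausdorffContent d S ≤ ∑ i ∈ s, hausdorffContent d (f i) := by
  simp only [hausdorffContent_eq_ofFunction hd]
  exact (MeasureTheory.measure_mono h).trans (MeasureTheory.measure_biUnion_finset_le _ _)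

/-- The measure is a supremum over mesh sizes of infima over finer covers; for any one mesh size,
dropping the mesh restriction only lowers the infimum. -/
lemma hausdorffContent_le_hausdorffMeasure [MeasurableSpace X] [BorelSpace X] {d : ℕ} (hd : 0 < d)
    (S : Set X) : hausdorffContent d S ≤ μH[(d : ℝ)] S := by
  rw [MeasureTheory.Measure.hausdorffMeasure_apply]
  refine le_iSup₂_of_le (1 : ℝ≥0∞) one_pos ?_
  refine le_iInf fun t => le_iInf fun ht => le_iInf fun _ => ?_
  refine (iInf₂_le t ht).trans (ENNReal.tsum_le_tsum fun i => ?_)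
  rcases (t i).eq_empty_or_nonempty with h | h
  · simp [h, hd.ne']
  · simp [h]

lemma hausdorffContent_le_of_subset_ball {d : ℕ} (hd : 0 < d) {S : Set X} {x : X} {r : ℝ}
    (hr : 0 ≤ r) (h : S ⊆ Metric.ball x r) : hausdorffContent d S ≤ ENNReal.ofReal ((2 * r) ^ d) := by
  refine (hausdorffContent_le_ediam_pow hd S).trans ?_
  rw [ENNReal.ofReal_pow (by positivity), ENNReal.ofReal_mul zero_le_two]
  gcongr
  refine (Metric.ediam_mono h).trans ?_
  refine Metric.ediam_le fun y hy z hz => ?_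
  rw [edist_dist, ← ENNReal.ofReal_mul zero_le_two]
  refine ENNReal.ofReal_le_ofReal ?_
  have := dist_triangle_right y z x
  rw [Metric.mem_ball] at hy hz
  linarith

end Content

namespace ChristDavidCubes

/-! ### From a subadditive weight to an additive one -/

section Weights

variable {X : Type*} [MetricSpace X] [MeasurableSpace X] [BorelSpace X] {E : Set X} {ρ : ℝ}
  {D : ChristDavidCubes E ρ}

open Classical in
/-- The sum of `h` over the children of `P` in `U`, relative to `h P`. -/
noncomputable def childRatio (U : Finset D.Cube) (h : D.Cube → ℝ) (P : D.Cube) : ℝ :=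
  (∑ Q ∈ U with Q ∈ P.children, h Q) / h P

open Classical in
/-- The product of the child ratios over the proper ancestors in `U`. -/
noncomputable def ratioProd (U : Finset D.Cube) (h : D.Cube → ℝ) (Q : D.Cube) : ℝ :=
  ∏ P ∈ U with Q < P, childRatio U h P

/-- `U` is the family of cubes below `Q₀` up to generation `k₀`, and `h` is a positive weight on it
that is subadditive with respect to children. -/
structure IsSubadditiveWeight (Q₀ : D.Cube) (k₀ : ℕ) (U : Finset D.Cube) (h : D.Cube → ℝ) :
    Prop where
  gen_top : Q₀.gen = 0
  mem_iff : ∀ Q, Q ∈ U ↔ Q ∈ upTo Q₀ k₀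
  pos : ∀ Q ∈ U, 0 < h Q
  le_childRatio : ∀ P ∈ U, P.gen < k₀ → 1 ≤ childRatio U h P

namespace IsSubadditiveWeight

variable {Q₀ : D.Cube} {k₀ : ℕ} {U : Finset D.Cube} {h : D.Cube → ℝ}

lemma mem_iff' (H : IsSubadditiveWeight Q₀ k₀ U h) {Q : D.Cube} :
    Q ∈ U ↔ Q ≤ Q₀ ∧ Q.gen ≤ k₀ := by
  rw [H.mem_iff]
  constructor
  · exact fun hQ => ⟨⟨H.gen_top ▸ hQ.1, hQ.2.2⟩, hQ.2.1⟩
  · exact fun hQ => ⟨H.gen_top ▸ hQ.1.1, hQ.2, hQ.1.2⟩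

lemma mem_of_le (H : IsSubadditiveWeight Q₀ k₀ U h) {Q P : D.Cube} (hP : P ∈ U) (hle : Q ≤ P)
    (hg : Q.gen ≤ k₀) : Q ∈ U :=
  H.mem_iff'.2 ⟨hle.trans (H.mem_iff'.1 hP).1, hg⟩

lemma child_mem (H : IsSubadditiveWeight Q₀ k₀ U h) {Q P : D.Cube} (hP : P ∈ U) (hg : P.gen < k₀)
    (hQ : Q ∈ P.children) : Q ∈ U :=
  H.mem_of_le hP (Cube.lt_of_mem_children hQ).le (by rw [hQ.1]; omega)

lemma one_le_childRatio_of_lt (H : IsSubadditiveWeight Q₀ k₀ U h) (hρ : 0 < ρ) {Q P : D.Cube}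
    (hQ : Q ∈ U) (hP : P ∈ U) (hlt : Q < P) : 1 ≤ childRatio U h P :=
  H.le_childRatio P hP ((Cube.gen_lt_of_lt hρ hlt).trans_le (H.mem_iff'.1 hQ).2)

lemma ratioProd_le (H : IsSubadditiveWeight Q₀ k₀ U h) (hρ : 0 < ρ) {Q P : D.Cube} (hQ : Q ∈ U)
    (hle : Q ≤ P) : ratioProd U h P ≤ ratioProd U h Q := by
  classical
  unfold ratioProd
  refine Finset.prod_le_prod_of_subset_of_one_le ?_ ?_ ?_
  · intro R hR
    rw [Finset.mem_filter] at hR ⊢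
    exact ⟨hR.1, hle.trans_lt hR.2⟩
  · intro R hR
    rw [Finset.mem_filter] at hR
    exact zero_le_one.trans (H.one_le_childRatio_of_lt hρ hQ hR.1 (hle.trans_lt hR.2))
  · intro R hR _
    rw [Finset.mem_filter] at hR
    exact H.one_le_childRatio_of_lt hρ hQ hR.1 hR.2

lemma one_le_ratioProd (H : IsSubadditiveWeight Q₀ k₀ U h) (hρ : 0 < ρ) {Q : D.Cube}
    (hQ : Q ∈ U) : 1 ≤ ratioProd U h Q := by
  classical
  unfold ratioProd
  refine Finset.one_le_prod fun R hR => ?_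
  rw [Finset.mem_filter] at hR
  exact H.one_le_childRatio_of_lt hρ hQ hR.1 hR.2

/-- The proper ancestors of a child are `P` and those of `P`. The right-hand side does not involve
the child, so siblings share one value; this is what makes the level sets obey condition (iii). -/
lemma ratioProd_child (hρ : 0 < ρ) {Q P : D.Cube}
    (hP : P ∈ U) (hQ : Q ∈ P.children) :
    ratioProd U h Q = ratioProd U h P * childRatio U h P := by
  classical
  unfold ratioProd
  have hQP := Cube.lt_of_mem_children hQ
  have : (U.filter fun R => Q < R) = insert P (U.filter fun R => P < R) := by
    ext R
    simp only [Finset.mem_insert, Finset.mem_filter]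
    constructor
    · rintro ⟨hR, hQR⟩
      by_cases hPR : P = R
      · exact Or.inl hPR.symm
      · have h1 := Cube.gen_lt_of_lt hρ hQR
        rw [hQ.1] at h1
        exact Or.inr ⟨hR, lt_of_le_of_ne
          (Cube.le_of_le_of_le hρ hQP.le hQR.le (by omega)) hPR⟩
    · rintro (rfl | ⟨hR, hPR⟩)
      · exact ⟨hP, hQP⟩
      · exact ⟨hR, hQP.trans hPR⟩
  rw [this, Finset.prod_insert (by simp), mul_comm]

/-- All children have the same denominator, and its additional factor `childRatio U h P` is exactly
the excess of their total over `h P`. -/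
lemma weight_eq_sum_children (H : IsSubadditiveWeight Q₀ k₀ U h) (hρ : 0 < ρ) {P : D.Cube}
    (hP : P ∈ U) (hg : P.gen < k₀) [DecidablePred (· ∈ P.children)] :
    h P / ratioProd U h P = ∑ Q ∈ U with Q ∈ P.children, h Q / ratioProd U h Q := by
  have h1 : ∀ Q ∈ U.filter (· ∈ P.children), h Q / ratioProd U h Q =
      h Q / (ratioProd U h P * childRatio U h P) := fun Q hQ => by
    rw [ratioProd_child hρ hP (Finset.mem_filter.1 hQ).2]
  rw [Finset.sum_congr rfl h1, ← Finset.sum_div]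
  have h2 : ∑ Q ∈ U with Q ∈ P.children, h Q = childRatio U h P * h P := by
    rw [childRatio, div_mul_cancel₀ _ (H.pos P hP).ne']
    congr!
  have h3 := H.le_childRatio P hP hg
  have h4 := H.one_le_ratioProd hρ hP
  rw [h2, mul_comm (ratioProd U h P), mul_div_mul_left _ _ (by positivity)]

/-- The weight of a cube is the sum of the weights of the bottom cubes below it. -/
lemma weight_eq_sum_bottom (H : IsSubadditiveWeight Q₀ k₀ U h) (hρ : 0 < ρ) {P : D.Cube}
    (hP : P ∈ U) [DecidablePred fun B : D.Cube => B.gen = (k₀ : ℤ) ∧ B ≤ P] :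
    h P / ratioProd U h P = ∑ B ∈ U with B.gen = (k₀ : ℤ) ∧ B ≤ P, h B / ratioProd U h B := by
  classical
  obtain ⟨m, hm⟩ : ∃ m : ℕ, P.gen + m = k₀ :=
    ⟨(k₀ - P.gen).toNat, by have := (H.mem_iff'.1 hP).2; omega⟩
  induction m generalizing P with
  | zero =>
    have : (U.filter fun B => B.gen = (k₀ : ℤ) ∧ B ≤ P) = {P} := by
      ext B
      simp only [Finset.mem_filter, Finset.mem_singleton]
      constructor
      · rintro ⟨-, hB, hle⟩
        exact Cube.eq_of_le_of_gen_eq hρ hle (by push_cast at hm; omega)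
      · rintro rfl
        exact ⟨hP, by push_cast at hm; omega, le_rfl⟩
    rw [this, Finset.sum_singleton]
  | succ m ih =>
    push_cast at hm
    rw [H.weight_eq_sum_children hρ hP (by omega)]
    have h1 : ∀ Q ∈ U.filter (· ∈ P.children), h Q / ratioProd U h Q =
        ∑ B ∈ U with B.gen = (k₀ : ℤ) ∧ B ≤ Q, h B / ratioProd U h B := fun Q hQ => by
      rw [Finset.mem_filter] at hQ
      exact ih hQ.1 (by rw [hQ.2.1]; omega)
    rw [Finset.sum_congr rfl h1, ← Finset.sum_biUnion]
    · congr 1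
      ext B
      simp only [Finset.mem_biUnion, Finset.mem_filter]
      constructor
      · rintro ⟨Q, ⟨hQ, hQP⟩, hB, hBk, hBQ⟩
        exact ⟨hB, hBk, hBQ.trans (Cube.lt_of_mem_children hQP).le⟩
      · rintro ⟨hB, hBk, hBP⟩
        have hlt : B < P := lt_of_le_of_ne hBP fun he => by rw [he] at hBk; omega
        obtain ⟨Q, hQ, hBQ⟩ := Cube.exists_child_ge hρ hlt
        exact ⟨Q, ⟨H.child_mem hP (by omega) hQ, hQ⟩, hB, hBk, hBQ⟩
    · intro Q hQ Q' hQ' hne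
      rw [Function.onFun, Finset.disjoint_left]
      intro B hB hB'
      simp only [Finset.coe_filter, Set.mem_ofPred_eq, Finset.mem_filter] at hQ hQ' hB hB'
      exact hne (Cube.eq_of_le_of_le hρ hB.2.2 hB'.2.2 (by rw [hQ.2.1, hQ'.2.1]))

lemma weight_pos (H : IsSubadditiveWeight Q₀ k₀ U h) (hρ : 0 < ρ) {Q : D.Cube} (hQ : Q ∈ U) :
    0 < h Q / ratioProd U h Q :=
  div_pos (H.pos Q hQ) (one_pos.trans_le (H.one_le_ratioProd hρ hQ))

/-- The weights of disjoint cubes below `P` add up to at most the weight of `P`. -/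
lemma sum_weight_le (H : IsSubadditiveWeight Q₀ k₀ U h) (hρ : 0 < ρ) {P : D.Cube} (hP : P ∈ U)
    (A : Finset D.Cube) (hA : ∀ Q ∈ A, Q ∈ U ∧ Q ≤ P)
    (hdisj : (A : Set D.Cube).PairwiseDisjoint Cube.carrier) :
    ∑ Q ∈ A, h Q / ratioProd U h Q ≤ h P / ratioProd U h P := by
  classical
  -- Disjoint cubes have disjoint sets of descendants in generation `k₀`, so everything reduces to a
  -- comparison of sums over bottom cubes.
  rw [H.weight_eq_sum_bottom hρ hP,
    Finset.sum_congr rfl fun Q hQ => H.weight_eq_sum_bottom hρ (hA Q hQ).1, ← Finset.sum_biUnion]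
  · refine Finset.sum_le_sum_of_subset_of_nonneg ?_ fun B hB _ =>
      (H.weight_pos hρ (Finset.mem_filter.1 hB).1).le
    intro B hB
    simp only [Finset.mem_biUnion, Finset.mem_filter] at hB ⊢
    obtain ⟨Q, hQ, hBU, hBk, hBQ⟩ := hB
    exact ⟨hBU, hBk, hBQ.trans (hA Q hQ).2⟩
  · intro Q hQ Q' hQ' hne
    rw [Function.onFun, Finset.disjoint_left]
    intro B hB hB'
    rw [Finset.mem_filter] at hB hB'
    exact Set.disjoint_left.1 (hdisj hQ hQ' hne) (hB.2.2.2 (B.ctr_mem hρ))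
      (hB'.2.2.2 (B.ctr_mem hρ))

end IsSubadditiveWeight

end Weights

end ChristDavidCubes

namespace ChristDavidCubes

/-! ### Trees as level sets of the ratio product -/

section Levels

variable {X : Type*} [MetricSpace X] [MeasurableSpace X] [BorelSpace X] {E : Set X} {ρ : ℝ}
  {D : ChristDavidCubes E ρ}

/-- The binary logarithm of the product of the child ratios above `Q`. -/
noncomputable def level (U : Finset D.Cube) (h : D.Cube → ℝ) (Q : D.Cube) : ℕ :=
  Nat.log 2 ⌊ratioProd U h Q⌋₊

/-- The cubes below `R` of the same level as `R`. -/
def levelTree (U : Finset D.Cube) (h : D.Cube → ℝ) (R : D.Cube) : Set D.Cube :=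
  {Q | Q ∈ U ∧ Q ≤ R ∧ level U h Q = level U h R}

/-- The maximal cubes of their level. -/
def levelTop (U : Finset D.Cube) (h : D.Cube → ℝ) : Set D.Cube :=
  {R | R ∈ U ∧ ∀ P ∈ U, R ≤ P → level U h P = level U h R → P = R}

lemma sum_two_pow_le_of_injOn {ι : Type*} (s : Finset ι) (f : ι → ℕ) (L : ℕ)
    (hf : Set.InjOn f s) (hL : ∀ i ∈ s, f i ≤ L) : ∑ i ∈ s, (2 : ℝ) ^ f i ≤ 2 ^ (L + 1) := by
  rw [← Finset.sum_image (f := fun k => (2 : ℝ) ^ k) hf]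
  calc _ ≤ ∑ k ∈ Finset.range (L + 1), (2 : ℝ) ^ k := by
        refine Finset.sum_le_sum_of_subset_of_nonneg ?_ fun k _ _ => by positivity
        intro k hk
        obtain ⟨i, hi, rfl⟩ := Finset.mem_image.1 hk
        exact Finset.mem_range.2 (Nat.lt_succ_of_le (hL i hi))
    _ = 2 ^ (L + 1) - 1 := by rw [geom_sum_eq (by norm_num)]; norm_num
    _ ≤ _ := by linarith

namespace IsSubadditiveWeight

variable {Q₀ : D.Cube} {k₀ : ℕ} {U : Finset D.Cube} {h : D.Cube → ℝ}

lemma two_pow_level_le (H : IsSubadditiveWeight Q₀ k₀ U h) (hρ : 0 < ρ) {Q : D.Cube}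
    (hQ : Q ∈ U) : (2 : ℝ) ^ level U h Q ≤ ratioProd U h Q := by
  have h1 := H.one_le_ratioProd hρ hQ
  -- Otherwise `Nat.log` would return its default value 0 and the power of two would exceed the
  -- floor.
  have h2 : ⌊ratioProd U h Q⌋₊ ≠ 0 := (Nat.floor_pos.2 h1).ne'
  calc (2 : ℝ) ^ level U h Q ≤ (⌊ratioProd U h Q⌋₊ : ℝ) := by
        exact_mod_cast Nat.pow_log_le_self 2 h2
    _ ≤ _ := Nat.floor_le (by linarith)

lemma ratioProd_lt (_H : IsSubadditiveWeight Q₀ k₀ U h) (Q : D.Cube) :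
    ratioProd U h Q < 2 ^ (level U h Q + 1) := by
  have h1 := Nat.lt_pow_succ_log_self one_lt_two ⌊ratioProd U h Q⌋₊
  have h2 := (Nat.floor_lt' (by positivity)).1 h1
  exact_mod_cast h2

lemma level_le (H : IsSubadditiveWeight Q₀ k₀ U h) (hρ : 0 < ρ) {Q P : D.Cube} (hQ : Q ∈ U)
    (hle : Q ≤ P) : level U h P ≤ level U h Q :=
  Nat.log_mono_right (Nat.floor_le_floor (H.ratioProd_le hρ hQ hle))

lemma levelTop_subset : levelTop U h ⊆ U := fun _ hR => hR.1

/-- Coherence is monotonicity of the level along ancestors. Condition (iii) holds because siblings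
have the same generation and the same ratio product, hence enter or leave the tree together. -/
lemma isStoppingTimeRegion_levelTree (H : IsSubadditiveWeight Q₀ k₀ U h) (hρ : 0 < ρ)
    {R : D.Cube} (hR : R ∈ U) : IsStoppingTimeRegion (levelTree U h R) R where
  greatest := ⟨⟨hR, le_rfl, rfl⟩, fun Q hQ => hQ.2.1⟩
  coherent := by
    rintro Q ⟨hQ, hQR, hl⟩ P hQP hPR
    have hP : P ∈ U := H.mem_of_le hR hPR (hQP.1.trans (H.mem_iff'.1 hQ).2)
    exact ⟨hP, hPR, le_antisymm (hl ▸ H.level_le hρ hQ hQP) (H.level_le hρ hP hPR)⟩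
  children := by
    rintro Q ⟨hQ, hQR, hl⟩ ⟨Q', hQ', hn⟩ Q'' hQ'' ⟨hU'', -, hl''⟩
    have hk := (H.mem_iff'.1 hU'').2
    refine hn ⟨H.mem_of_le hQ (Cube.lt_of_mem_children hQ').le (by rw [hQ'.1, ← hQ''.1]; exact hk),
      (Cube.lt_of_mem_children hQ').le.trans hQR, ?_⟩
    rw [← hl'']
    unfold level
    rw [ratioProd_child hρ hQ hQ', ratioProd_child hρ hQ hQ'']

lemma eq_of_le_of_level_eq {R R' : D.Cube} (hR : R ∈ levelTop U h)
    (hR' : R' ∈ levelTop U h) (hle : R ≤ R') (hl : level U h R' = level U h R) : R = R' :=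
  (hR.2 R' hR'.1 hle hl).symm

lemma pairwiseDisjoint_levelTree (hρ : 0 < ρ) :
    (levelTop U h).PairwiseDisjoint (levelTree U h) := by
  intro R hR R' hR' hne
  rw [Function.onFun, Set.disjoint_left]
  rintro Q ⟨-, h1, hl⟩ ⟨-, h1', hl'⟩
  rcases le_total R'.gen R.gen with hg | hg
  · exact hne (eq_of_le_of_level_eq hR hR' (Cube.le_of_le_of_le hρ h1 h1' hg)
      (hl'.symm.trans hl))
  · exact hne (eq_of_le_of_level_eq hR' hR (Cube.le_of_le_of_le hρ h1' h1 hg)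
      (hl.symm.trans hl')).symm

lemma iUnion_levelTree : (⋃ R ∈ levelTop U h, levelTree U h R) = U := by
  apply Set.Subset.antisymm
  · exact Set.iUnion₂_subset fun R _ Q hQ => hQ.1
  · intro Q hQ
    obtain ⟨R, ⟨hRU, hQR, hl⟩, hmax⟩ :=
      (U.finite_toSet.subset (t := {R | R ∈ U ∧ Q ≤ R ∧ level U h R = level U h Q})
        fun R hR => hR.1).exists_maximal ⟨Q, hQ, le_rfl, rfl⟩
    simp only [Set.mem_iUnion]
    refine ⟨R, ⟨hRU, fun P hP hRP hlP => ?_⟩, hQ, hQR, hl.symm⟩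
    exact le_antisymm (hmax ⟨hP, hQR.trans hRP, hlP.trans hl⟩ hRP) hRP

/-- Packing of the top cubes. -/
lemma sum_levelTop_le (H : IsSubadditiveWeight Q₀ k₀ U h) (hρ : 0 < ρ) (A : Finset D.Cube)
    (hA : (A : Set D.Cube) ⊆ levelTop U h) [DecidablePred fun B : D.Cube => B.gen = (k₀ : ℤ)] :
    ∑ R ∈ A, h R ≤ 4 * ∑ B ∈ U with B.gen = (k₀ : ℤ), h B := by
  classical
  have hAU : ∀ R ∈ A, R ∈ U := fun R hR => levelTop_subset (hA hR)
  -- Each top cube is distributed over the bottom cubes below it, at the price of replacing its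
  -- ratio product by the next power of two.
  have h1 : ∀ R ∈ A, h R ≤ ∑ B ∈ U with B.gen = (k₀ : ℤ),
      if B ≤ R then 2 ^ (level U h R + 1) * (h B / ratioProd U h B) else 0 := by
    intro R hR
    have hg := H.one_le_ratioProd hρ (hAU R hR)
    calc h R = ratioProd U h R * (h R / ratioProd U h R) := by field_simp
      _ = ratioProd U h R * ∑ B ∈ U with B.gen = (k₀ : ℤ) ∧ B ≤ R, h B / ratioProd U h B := by
        rw [H.weight_eq_sum_bottom hρ (hAU R hR)]
      _ ≤ 2 ^ (level U h R + 1) *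
          ∑ B ∈ U with B.gen = (k₀ : ℤ) ∧ B ≤ R, h B / ratioProd U h B := by
        refine mul_le_mul_of_nonneg_right (H.ratioProd_lt R).le ?_
        exact Finset.sum_nonneg fun B hB => (H.weight_pos hρ (Finset.mem_filter.1 hB).1).le
      _ = _ := by rw [Finset.mul_sum, ← Finset.filter_filter, Finset.sum_filter (fun B => B ≤ R)]
  refine (Finset.sum_le_sum h1).trans ?_
  rw [Finset.sum_comm, Finset.mul_sum]
  refine Finset.sum_le_sum fun B hB => ?_
  have hBU := (Finset.mem_filter.1 hB).1
  have hw := H.weight_pos hρ hBU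
  rw [← Finset.sum_filter, ← Finset.sum_mul]
  -- The top cubes above `B` form a chain with pairwise distinct levels, none exceeding that of `B`,
  -- so the geometric sum is governed by its last term.
  have h2 : ∑ R ∈ A with B ≤ R, (2 : ℝ) ^ (level U h R + 1) ≤ 4 * ratioProd U h B := by
    calc ∑ R ∈ A with B ≤ R, (2 : ℝ) ^ (level U h R + 1)
        = 2 * ∑ R ∈ A with B ≤ R, (2 : ℝ) ^ level U h R := by
          rw [Finset.mul_sum]; exact Finset.sum_congr rfl fun R _ => by ring
      _ ≤ 2 * 2 ^ (level U h B + 1) := by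
          refine mul_le_mul_of_nonneg_left (sum_two_pow_le_of_injOn _ _ _ ?_ ?_) zero_le_two
          · intro R hR R' hR' hl
            simp only [Finset.coe_filter, Set.mem_ofPred_eq] at hR hR'
            rcases le_total R'.gen R.gen with hg | hg
            · exact eq_of_le_of_level_eq (hA hR.1) (hA hR'.1)
                (Cube.le_of_le_of_le hρ hR.2 hR'.2 hg) hl.symm
            · exact (eq_of_le_of_level_eq (hA hR'.1) (hA hR.1)
                (Cube.le_of_le_of_le hρ hR'.2 hR.2 hg) hl).symm
          · intro R hR
            exact H.level_le hρ hBU (Finset.mem_filter.1 hR).2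
      _ = 4 * 2 ^ level U h B := by ring
      _ ≤ _ := mul_le_mul_of_nonneg_left (H.two_pow_level_le hρ hBU) (by norm_num)
  have h3 := H.one_le_ratioProd hρ hBU
  calc _ ≤ 4 * ratioProd U h B * (h B / ratioProd U h B) :=
        mul_le_mul_of_nonneg_right h2 hw.le
    _ = _ := by field_simp

end IsSubadditiveWeight

end Levels

/-! ### Regular weights on trees, and measures of disjoint cubes -/

section Corona

variable {X : Type*} [MetricSpace X] [MeasurableSpace X] [BorelSpace X] {E : Set X} {ρ : ℝ}
  {D : ChristDavidCubes E ρ}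

/-- `w` is comparable to the `d`-th power of the side length on `T`, and superadditive. -/
structure IsRegularWeight (d : ℕ) (a b : ℝ) (T : Set D.Cube) (w : D.Cube → ℝ) : Prop where
  lower : ∀ Q ∈ T, a * Q.side ^ d ≤ w Q
  upper : ∀ Q ∈ T, w Q ≤ b * Q.side ^ d
  sum_le : ∀ P ∈ T, ∀ A : Finset D.Cube, (∀ Q ∈ A, Q ∈ T ∧ Q ≤ P) →
    (A : Set D.Cube).PairwiseDisjoint Cube.carrier → ∑ Q ∈ A, w Q ≤ w P

lemma IsRegularWeight.mono {d : ℕ} {a b : ℝ} {T T' : Set D.Cube} {w : D.Cube → ℝ}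
    (h : IsRegularWeight d a b T w) (hT : T' ⊆ T) : IsRegularWeight d a b T' w where
  lower Q hQ := h.lower Q (hT hQ)
  upper Q hQ := h.upper Q (hT hQ)
  sum_le P hP A hA hd := h.sum_le P (hT hP) A (fun Q hQ => ⟨hT (hA Q hQ).1, (hA Q hQ).2⟩) hd

/-- On a tree of level k the ratio product lies in [2^k, 2^(k+1)), so the rescaled weight lies
between `h Q / 2` and `h Q`, while the constant factor 2^k does not affect superadditivity. -/
lemma IsSubadditiveWeight.isRegularWeight {Q₀ : D.Cube} {k₀ : ℕ} {U : Finset D.Cube}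
    {h : D.Cube → ℝ} (H : IsSubadditiveWeight Q₀ k₀ U h) (hρ : 0 < ρ) {d : ℕ} {a b : ℝ}
    (ha : ∀ Q ∈ U, a * Q.side ^ d ≤ h Q) (hb : ∀ Q ∈ U, h Q ≤ b * Q.side ^ d) (R : D.Cube) :
    IsRegularWeight d (a / 2) b (levelTree U h R)
      (fun Q => 2 ^ level U h R * (h Q / ratioProd U h Q)) where
  lower := by
    rintro Q ⟨hQ, -, hl⟩
    have h1 := H.ratioProd_lt Q
    have h2 := H.one_le_ratioProd hρ hQ
    have h3 := H.pos Q hQ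
    have h4 := ha Q hQ
    rw [hl, pow_succ] at h1
    rw [← mul_div_assoc, le_div_iff₀ (by linarith)]
    calc a / 2 * Q.side ^ d * ratioProd U h Q ≤ h Q / 2 * ratioProd U h Q := by
          apply mul_le_mul_of_nonneg_right <;> linarith
      _ ≤ h Q / 2 * (2 ^ level U h R * 2) := by gcongr
      _ = _ := by ring
  upper := by
    rintro Q ⟨hQ, -, hl⟩
    have h1 := H.two_pow_level_le hρ hQ
    have h2 := H.one_le_ratioProd hρ hQ
    have h3 := H.pos Q hQ
    refine le_trans ?_ (hb Q hQ)
    rw [← mul_div_assoc, div_le_iff₀ (by linarith), ← hl, mul_comm]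
    gcongr
  sum_le := by
    intro P hP A hA hd
    rw [← Finset.mul_sum]
    exact mul_le_mul_of_nonneg_left
      (H.sum_weight_le hρ hP.1 A (fun Q hQ => ⟨(hA Q hQ).1.1, (hA Q hQ).2⟩) hd) (by positivity)

/-- The Hausdorff measures of disjoint cubes add up to at most that of a cube containing them. -/
lemma sum_hausdorffMeasure_le (d : ℝ) (A : Finset D.Cube)
    (hA : (A : Set D.Cube).PairwiseDisjoint Cube.carrier) {S : Set X}
    (hS : ∀ Q ∈ A, Q.carrier ⊆ S) : ∑ Q ∈ A, μH[d] Q.carrier ≤ μH[d] S := by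
  -- `E` need not be measurable, so the cubes are only traces of Borel sets. Additivity is applied
  -- to those Borel sets under the measure restricted to `E`.
  choose M hM hQM using fun Q : D.Cube => D.borel Q.gen Q.carrier Q.mem
  have h1 : ∀ Q : D.Cube, (μH[d] : MeasureTheory.Measure X).restrict E (M Q) = μH[d] Q.carrier :=
    fun Q => by rw [MeasureTheory.Measure.restrict_apply (hM Q), hQM Q, Set.inter_comm]
  rw [← Finset.sum_congr rfl fun Q _ => h1 Q, ← MeasureTheory.measure_biUnion_finset₀ _
    fun Q _ => (hM Q).nullMeasurableSet,
    MeasureTheory.Measure.restrict_apply (Finset.measurableSet_biUnion _ fun Q _ => hM Q)]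
  · refine MeasureTheory.measure_mono ?_
    rintro x ⟨hx, hxE⟩
    simp only [Set.mem_iUnion] at hx
    obtain ⟨Q, hQ, hxQ⟩ := hx
    exact hS Q hQ ((hQM Q).symm ▸ ⟨hxE, hxQ⟩)
  · intro Q hQ Q' hQ' hne
    rw [Function.onFun, MeasureTheory.AEDisjoint,
      MeasureTheory.Measure.restrict_apply ((hM Q).inter (hM Q'))]
    have : M Q ∩ M Q' ∩ E = ∅ := by
      rw [← Set.disjoint_iff_inter_eq_empty.1 (hA hQ hQ' hne), hQM Q, hQM Q']
      ext x; simp only [Set.mem_inter_iff]; tauto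
    rw [this, MeasureTheory.measure_empty]

end Corona

end ChristDavidCubes

namespace ChristDavidCubes

/-! ### The content as a subadditive weight -/

section ContentWeight

variable {X : Type*} [MetricSpace X] [MeasurableSpace X] [BorelSpace X] {E : Set X} {ρ : ℝ}
  {D : ChristDavidCubes E ρ}

lemma Cube.side_le_five (hρ : 0 < ρ) (hρ1 : ρ < 1) {Q : D.Cube} (hQ : 0 ≤ Q.gen) :
    Q.side ≤ 5 := by
  unfold Cube.side
  have := zpow_le_one₀ hρ hρ1.le hQ
  linarith

lemma Cube.content_le {d : ℕ} (hd : 0 < d) (hρ : 0 < ρ) (Q : D.Cube) :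
    hausdorffContent d Q.carrier ≤ ENNReal.ofReal ((2 * Q.side) ^ d) :=
  hausdorffContent_le_of_subset_ball hd (Q.side_pos hρ).le fun _ hx => Q.dist_ctr_lt hx

lemma Cube.content_ne_top {d : ℕ} (hd : 0 < d) (hρ : 0 < ρ) (Q : D.Cube) :
    hausdorffContent d Q.carrier ≠ ⊤ :=
  ((Q.content_le hd hρ).trans_lt ENNReal.ofReal_lt_top).ne

lemma Cube.le_content {d : ℕ} (hd : 0 < d) (hρ : 0 < ρ) (hρ1 : ρ < 1) {c : ℝ}
    (hE : IsLowerContentRegular c d E) (hdiam : 1 ≤ Metric.ediam E) {Q : D.Cube}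
    (hQ : 0 ≤ Q.gen) :
    ENNReal.ofReal (c / 500 ^ d * Q.side ^ d) ≤ hausdorffContent d Q.carrier := by
  have h1 := Q.side_pos hρ
  have h2 := Cube.side_le_five hρ hρ1 hQ
  -- The inner radius is at most 5/500 < 1 ≤ diam `E`, so content regularity applies to it.
  have h3 : ENNReal.ofReal (Q.side / 500) < Metric.ediam E := by
    refine lt_of_lt_of_le ?_ hdiam
    rw [ENNReal.ofReal_lt_one]; linarith
  have h4 := hE Q.ctr Q.ctr_mem_ambient (Q.side / 500) (by positivity) h3
  rw [show c / 500 ^ d * Q.side ^ d = c * (Q.side / 500) ^ d by rw [div_pow]; ring]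
  refine h4.trans (hausdorffContent_mono hd ?_)
  exact fun x hx => Q.mem_of_dist_lt hx.1 hx.2

/-- The Hausdorff content of a cube, as a real number. -/
noncomputable def contentWeight (d : ℕ) (Q : D.Cube) : ℝ := (hausdorffContent d Q.carrier).toReal

lemma contentWeight_nonneg (d : ℕ) (Q : D.Cube) : 0 ≤ contentWeight d Q := ENNReal.toReal_nonneg

lemma contentWeight_le {d : ℕ} (hd : 0 < d) (hρ : 0 < ρ) (Q : D.Cube) :
    contentWeight d Q ≤ 2 ^ d * Q.side ^ d := by
  have h1 := Q.side_pos hρ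
  rw [← mul_pow]
  exact ENNReal.toReal_le_of_le_ofReal (by positivity) (Q.content_le hd hρ)

lemma le_contentWeight {d : ℕ} (hd : 0 < d) (hρ : 0 < ρ) (hρ1 : ρ < 1) {c : ℝ}
    (hE : IsLowerContentRegular c d E) (hdiam : 1 ≤ Metric.ediam E) {Q : D.Cube}
    (hQ : 0 ≤ Q.gen) : c / 500 ^ d * Q.side ^ d ≤ contentWeight d Q :=
  (ENNReal.ofReal_le_iff_le_toReal (Q.content_ne_top hd hρ)).1 (Q.le_content hd hρ hρ1 hE hdiam hQ)

lemma isSubadditiveWeight_contentWeight {d : ℕ} (hd : 0 < d) (hρ : 0 < ρ) (hρ1 : ρ < 1) {c : ℝ}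
    (hc : 0 < c) (hE : IsLowerContentRegular c d E) (hdiam : 1 ≤ Metric.ediam E) {Q₀ : D.Cube}
    (hQ₀ : Q₀.gen = 0) (k₀ : ℕ) (hfin : (upTo Q₀ k₀).Finite) :
    IsSubadditiveWeight Q₀ k₀ hfin.toFinset (contentWeight d) where
  gen_top := hQ₀
  mem_iff := by simp
  pos := by
    intro Q hQ
    have h1 := Q.side_pos hρ
    refine lt_of_lt_of_le ?_ (le_contentWeight hd hρ hρ1 hE hdiam (hfin.mem_toFinset.1 hQ).1)
    positivity
  le_childRatio := by
    classical
    intro P hP hg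
    rw [hfin.mem_toFinset] at hP
    have h1 := P.side_pos hρ
    have hpos : 0 < contentWeight d P := by
      refine lt_of_lt_of_le ?_ (le_contentWeight hd hρ hρ1 hE hdiam hP.1)
      positivity
    rw [childRatio, one_le_div hpos]
    unfold contentWeight
    rw [← ENNReal.toReal_sum fun Q _ => Q.content_ne_top hd hρ]
    refine ENNReal.toReal_mono
      (ENNReal.sum_lt_top.2 fun Q _ => (Q.content_ne_top hd hρ).lt_top).ne ?_
    refine hausdorffContent_le_sum hd _ _ fun x hx => ?_
    obtain ⟨Q, hQ, hxQ⟩ := Cube.exists_mem_children hx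
    simp only [Set.mem_iUnion, Finset.mem_filter, hfin.mem_toFinset]
    refine ⟨Q, ⟨⟨?_, ?_, hQ.2.trans hP.2.2⟩, hQ⟩, hxQ⟩
    · rw [hQ.1]; have := hP.1; omega
    · rw [hQ.1]; omega

end ContentWeight

/-- The cubes up to a given generation decompose into stopping-time regions with regular weights
whose top cubes satisfy a packing condition. -/
theorem exists_corona {n : ℕ} {ρ : ℝ} (hρ : 0 < ρ) (hρ1 : ρ < 1) {d : ℕ} (hd : 0 < d) {c : ℝ}
    (hc : 0 < c) {E : Set (EuclideanSpace ℝ (Fin n))} (hE : IsLowerContentRegular c d E)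
    (hdiam : 1 ≤ Metric.ediam E) {D : ChristDavidCubes E ρ} {Q₀ : D.Cube} (hQ₀ : Q₀.gen = 0)
    (k₀ : ℕ) :
    ∃ (Top : Set D.Cube) (Tree : D.Cube → Set D.Cube), Top ⊆ upTo Q₀ k₀ ∧
      (∀ R ∈ Top, IsStoppingTimeRegion (Tree R) R) ∧ Top.PairwiseDisjoint Tree ∧
      (⋃ R ∈ Top, Tree R) = upTo Q₀ k₀ ∧
      (∑' R : Top, ENNReal.ofReal ((R : D.Cube).side ^ d)
        ≤ ENNReal.ofReal (4 * (500 ^ d / c)) * μH[(d : ℝ)] Q₀.carrier) ∧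
      ∀ R ∈ Top, ∃ w, IsRegularWeight d (c / 500 ^ d / 2) (2 ^ d) (Tree R) w := by
  classical
  have hfin := finite_upTo hρ Q₀ k₀
  have H := isSubadditiveWeight_contentWeight hd hρ hρ1 hc hE hdiam hQ₀ k₀ hfin
  set U := hfin.toFinset with hU
  have hmem : ∀ Q, Q ∈ U ↔ Q ∈ upTo Q₀ k₀ := fun Q => hfin.mem_toFinset
  have hlow : ∀ Q ∈ U, c / 500 ^ d * Q.side ^ d ≤ contentWeight d Q :=
    fun Q hQ => le_contentWeight hd hρ hρ1 hE hdiam ((hmem Q).1 hQ).1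
  refine ⟨levelTop U (contentWeight d), levelTree U (contentWeight d),
    fun R hR => (hmem R).1 hR.1, fun R hR => H.isStoppingTimeRegion_levelTree hρ hR.1,
    IsSubadditiveWeight.pairwiseDisjoint_levelTree hρ,
    IsSubadditiveWeight.iUnion_levelTree.trans hfin.coe_toFinset, ?_,
    fun R _ => ⟨_, H.isRegularWeight hρ hlow (fun Q _ => contentWeight_le hd hρ Q) R⟩⟩
  obtain ⟨A, hA⟩ := (U.finite_toSet.subset
    (IsSubadditiveWeight.levelTop_subset (h := contentWeight d))).exists_finset_coe
  rw [← hA, Finset.tsum_subtype' A fun R : D.Cube => ENNReal.ofReal (R.side ^ d),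
    ← ENNReal.ofReal_sum_of_nonneg fun R _ => pow_nonneg (R.side_pos hρ).le d]
  have h1 : ∑ R ∈ A, R.side ^ d ≤ 4 * (500 ^ d / c) * ∑ B ∈ U with B.gen = (k₀ : ℤ),
      contentWeight d B := by
    calc ∑ R ∈ A, R.side ^ d = 500 ^ d / c * ∑ R ∈ A, c / 500 ^ d * R.side ^ d := by
          rw [← Finset.mul_sum, ← mul_assoc, div_mul_div_cancel₀ (by positivity),
            div_self (by positivity), one_mul]
      _ ≤ 500 ^ d / c * ∑ R ∈ A, contentWeight d R := by
          refine mul_le_mul_of_nonneg_left ?_ (by positivity)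
          exact Finset.sum_le_sum fun R hR =>
            hlow R (IsSubadditiveWeight.levelTop_subset (hA.subset hR))
      _ ≤ 500 ^ d / c * (4 * ∑ B ∈ U with B.gen = (k₀ : ℤ), contentWeight d B) :=
          mul_le_mul_of_nonneg_left (H.sum_levelTop_le hρ A hA.subset) (by positivity)
      _ = _ := by ring
  refine (ENNReal.ofReal_le_ofReal h1).trans ?_
  rw [ENNReal.ofReal_mul (by positivity)]
  gcongr
  rw [ENNReal.ofReal_sum_of_nonneg fun B _ => contentWeight_nonneg d B]
  -- Passing from content to measure only now, on disjoint cubes of one generation, removes every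
  -- dependence on `k₀`.
  calc _ ≤ ∑ B ∈ U with B.gen = (k₀ : ℤ), μH[(d : ℝ)] B.carrier := by
        refine Finset.sum_le_sum fun B _ => ?_
        rw [contentWeight, ENNReal.ofReal_toReal (B.content_ne_top hd hρ)]
        exact hausdorffContent_le_hausdorffMeasure hd _
    _ ≤ _ := by
        refine sum_hausdorffMeasure_le _ _ ?_ ?_
        · intro Q hQ R hR hne
          simp only [Finset.coe_filter, Set.mem_ofPred_eq] at hQ hR
          exact Cube.disjoint_of_gen_eq (hR.2.trans hQ.2.symm) hne
        · exact fun Q hQ => ((hmem Q).1 (Finset.mem_filter.1 hQ).1).2.2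

end ChristDavidCubes

namespace ChristDavidCubes

/-! ### Packing of cubes near the complement of a cube -/

section Boundary

variable {X : Type*} [MetricSpace X] [MeasurableSpace X] [BorelSpace X] {E : Set X} {ρ : ℝ}
  {D : ChristDavidCubes E ρ} {T : Set D.Cube} {T₀ : D.Cube}

/-- Around the center of `Q` there is a cube `W` of the region such that the cubes of the region at
least `m` generations below `Q` either avoid `W` or are within a small distance of the center. -/
lemma IsStoppingTimeRegion.exists_hole (hT : IsStoppingTimeRegion T T₀) (hfin : T.Finite)
    (hρ : 0 < ρ) {Q : D.Cube} (hQ : Q ∈ T) (m : ℕ) :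
    ∃ W ∈ T, W ≤ Q ∧ W.gen ≤ Q.gen + m ∧ ∀ Q' ∈ T, Q.gen + m ≤ Q'.gen →
      (W.carrier ∩ Q'.carrier).Nonempty →
        W.gen = Q.gen + m ∧ Q.ctr ∈ W.carrier ∧ Q' ≤ W := by
  -- `W` is the deepest cube of the region between `Q` and this `V`. If `W` is not `V`, then nothing
  -- in the region lies properly below `W`, since otherwise the child of `W` towards `V` would be in
  -- the region too.
  obtain ⟨V, hVg, hVc, hVQ⟩ := Q.exists_le_of_mem (k := Q.gen + m) (by omega) (Q.ctr_mem hρ)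
  obtain ⟨W, ⟨hWT, hVW, hWQ⟩, hmax⟩ :=
    (hfin.subset (t := {W | W ∈ T ∧ V ≤ W ∧ W ≤ Q}) fun W hW => hW.1).exists_maximalFor
      (fun Q => Q.gen) _ ⟨Q, hQ, hVQ, le_rfl⟩
  have hWg : W.gen ≤ Q.gen + m := hVg ▸ hVW.1
  refine ⟨W, hWT, hWQ, hWg, fun Q' hQ' hg hne => ?_⟩
  have hQ'W : Q' ≤ W := Cube.le_of_inter (hWg.trans hg) hne
  refine ⟨?_, hVW.2 hVc, hQ'W⟩
  by_contra hcon
  have hlt : Q' < W := lt_of_le_of_ne hQ'W fun h => hcon (by rw [h] at hg; omega)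
  have hVlt : V < W := lt_of_le_of_ne hVW fun h => hcon (by rw [← h]; exact hVg)
  obtain ⟨P, hP, hVP⟩ := Cube.exists_child_ge hρ hVlt
  have hPT := hT.children_subset hρ hWT hQ' hlt hP
  have h1 : P.gen ≤ W.gen := hmax ⟨hPT, hVP, (Cube.lt_of_mem_children hP).le.trans hWQ⟩
    (by show W.gen ≤ P.gen; rw [hP.1]; omega)
  rw [hP.1] at h1; omega

/-- Chooses the depth of the holes; 1/500 is the inner radius of a cube relative to its side length.
-/
lemma exists_pow_mul_lt {ρ : ℝ} (hρ : 0 < ρ) (hρ1 : ρ < 1) (M : ℝ) :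
    ∃ m : ℕ, 0 < m ∧ M * ρ ^ m < 1 / 500 := by
  have h1 : Filter.Tendsto (fun m : ℕ => M * ρ ^ m) Filter.atTop (nhds (M * 0)) :=
    (tendsto_pow_atTop_nhds_zero_of_lt_one hρ.le hρ1).const_mul M
  rw [mul_zero] at h1
  obtain ⟨m, hm, hm0⟩ := ((h1.eventually (gt_mem_nhds (by norm_num : (0 : ℝ) < 1 / 500))).and
    (Filter.eventually_gt_atTop 0)).exists
  exact ⟨m, hm0, hm⟩

/-- The cubes of a region below `P` that are near the complement of `P` at their own scale satisfy
a packing condition. -/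
theorem exists_boundary_packing {ρ : ℝ} (hρ : 0 < ρ) (hρ1 : ρ < 1) (d : ℕ) {a b : ℝ} (ha : 0 < a)
    (hb : 0 < b) {M : ℝ} (hM : 0 < M) :
    ∃ C > 0, ∀ {X : Type*} [MetricSpace X] [MeasurableSpace X] [BorelSpace X] {E : Set X}
      {D : ChristDavidCubes E ρ} {T : Set D.Cube} {T₀ : D.Cube} {w : D.Cube → ℝ},
      IsStoppingTimeRegion T T₀ → T.Finite → IsRegularWeight d a b T w →
      ∀ P ∈ T, ∀ A : Finset D.Cube,
        (∀ Q ∈ A, Q ∈ T ∧ Q ≤ P ∧ ∃ y ∈ E, y ∉ P.carrier ∧ dist y Q.ctr ≤ M * Q.side) →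
        ∑ Q ∈ A, Q.side ^ d ≤ C * P.side ^ d := by
  obtain ⟨m, hm0, hm⟩ := exists_pow_mul_lt hρ hρ1 (M + 2)
  have hρm : 0 < ρ ^ m := by positivity
  refine ⟨(m * b) / ((ρ ^ m) ^ d * a), by positivity, ?_⟩
  intro X _ _ _ E D T T₀ w hT hfin hw P hP A hA
  have hex : ∀ Q : D.Cube, ∃ W : D.Cube, Q ∈ T → W ∈ T ∧ W ≤ Q ∧ W.gen ≤ Q.gen + m ∧
      ∀ Q' ∈ T, Q.gen + m ≤ Q'.gen → (W.carrier ∩ Q'.carrier).Nonempty →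
        W.gen = Q.gen + m ∧ Q.ctr ∈ W.carrier ∧ Q' ≤ W := fun Q => by
    by_cases hQ : Q ∈ T
    · obtain ⟨W, hW⟩ := hT.exists_hole hfin hρ hQ m
      exact ⟨W, fun _ => hW⟩
    · exact ⟨Q, fun h => absurd h hQ⟩
  choose W hW using hex
  -- If the holes met, `Q'` would lie in `W Q`, itself of side ρ^m ℓ(Q) and containing the center of
  -- `Q`. The point `y` outside `P` would then be within (M+2)ρ^m ℓ(Q) < ℓ(Q)/500 of that center,
  -- hence in `Q` and in `P`.
  have hdisj : ∀ Q ∈ A, ∀ Q' ∈ A, Q.gen + m ≤ Q'.gen →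
      Disjoint (W Q).carrier (W Q').carrier := by
    intro Q hQ Q' hQ' hg
    obtain ⟨-, hWQ, -, hhole⟩ := hW Q (hA Q hQ).1
    obtain ⟨hQ'T, -, y, hyE, hyP, hyQ'⟩ := hA Q' hQ'
    rw [Set.disjoint_left]
    intro x hx hx'
    obtain ⟨hWg, hcW, hQ'W⟩ := hhole Q' hQ'T hg ⟨x, hx, (hW Q' hQ'T).2.1.2 hx'⟩
    have hs := Q.side_pos hρ
    have hWs : (W Q).side = ρ ^ m * Q.side := Cube.side_eq_mul hρ hWg
    have h1 : Q'.side ≤ ρ ^ m * Q.side := hWs ▸ Cube.side_le_side hρ hρ1.le hQ'W.1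
    have h2 := (W Q).dist_ctr_lt hcW
    have h3 := Cube.dist_ctr_lt_of_le hρ hQ'W
    have h4 : Q.side / 500 ≤ dist y Q.ctr := by
      by_contra! hlt
      exact hyP ((hA Q hQ).2.1.2 (Q.mem_of_dist_lt hyE hlt))
    have h5 := dist_triangle4 y Q'.ctr (W Q).ctr Q.ctr
    rw [dist_comm (W Q).ctr] at h5
    have h6 : M * Q'.side ≤ M * (ρ ^ m * Q.side) := by gcongr
    have h7 : (M + 2) * ρ ^ m * Q.side < 1 / 500 * Q.side := by gcongr
    rw [hWs] at h2 h3
    linarith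
  have hdisj' : ∀ Q ∈ A, ∀ Q' ∈ A, Q.gen % m = Q'.gen % m → Q ≠ Q' →
      Disjoint (W Q).carrier (W Q').carrier := by
    intro Q hQ Q' hQ' hmod hne
    have key : ∀ {x y : ℤ}, x % m = y % m → x < y → x + m ≤ y := fun {x y} h hlt => by
      have h1 : (m : ℤ) ∣ y - x := Int.ModEq.dvd h
      have := Int.le_of_dvd (by omega) h1
      omega
    rcases lt_trichotomy Q.gen Q'.gen with h | h | h
    · exact hdisj Q hQ Q' hQ' (key hmod h)
    · exact (Cube.disjoint_of_gen_eq h.symm hne).mono (hW Q (hA Q hQ).1).2.1.2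
        (hW Q' (hA Q' hQ').1).2.1.2
    · exact (hdisj Q' hQ' Q hQ (key hmod.symm h)).symm
  -- Within each of the `m` residue classes of generations the holes are disjoint, so each class
  -- costs at most `w P`.
  have hsum : ∑ Q ∈ A, w (W Q) ≤ m * w P := by
    classical
    have hm' : (m : ℤ) ≠ 0 := by omega
    rw [← Finset.sum_fiberwise_of_maps_to (s := A) (t := Finset.range m)
      (g := fun Q => (Q.gen % (m : ℤ)).toNat) (fun Q _ => by
        have h1 := Int.emod_nonneg Q.gen hm'
        have h2 := Int.emod_lt_of_pos Q.gen (by omega : (0 : ℤ) < m)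
        rw [Finset.mem_range]; omega)]
    have : ∀ i ∈ Finset.range m,
        ∑ Q ∈ A with (Q.gen % (m : ℤ)).toNat = i, w (W Q) ≤ w P := by
      intro i _
      have hd : ∀ Q ∈ A.filter (fun Q => (Q.gen % (m : ℤ)).toNat = i),
          ∀ Q' ∈ A.filter (fun Q => (Q.gen % (m : ℤ)).toNat = i), Q ≠ Q' →
          Disjoint (W Q).carrier (W Q').carrier := by
        intro Q hQ Q' hQ' hne
        rw [Finset.mem_filter] at hQ hQ'
        refine hdisj' Q hQ.1 Q' hQ'.1 ?_ hne
        have h1 := Int.emod_nonneg Q.gen hm'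
        have h2 := Int.emod_nonneg Q'.gen hm'
        omega
      have hinj : Set.InjOn W (A.filter (fun Q => (Q.gen % (m : ℤ)).toNat = i) : Set D.Cube) := by
        intro Q hQ Q' hQ' he
        by_contra hne
        have h1 := hd Q (by exact_mod_cast hQ) Q' (by exact_mod_cast hQ') hne
        rw [← he] at h1
        exact Set.disjoint_left.1 h1 ((W Q).ctr_mem hρ) ((W Q).ctr_mem hρ)
      rw [← Finset.sum_image (f := w) hinj]
      refine hw.sum_le P hP _ ?_ ?_
      · intro V hV
        obtain ⟨Q, hQ, rfl⟩ := Finset.mem_image.1 hV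
        have hQA := hA Q (Finset.mem_filter.1 hQ).1
        exact ⟨(hW Q hQA.1).1, (hW Q hQA.1).2.1.trans hQA.2.1⟩
      · intro V hV V' hV' hne
        obtain ⟨Q, hQ, rfl⟩ := Finset.mem_image.1 (Finset.mem_coe.1 hV)
        obtain ⟨Q', hQ', rfl⟩ := Finset.mem_image.1 (Finset.mem_coe.1 hV')
        exact hd Q hQ Q' hQ' fun h => hne (by rw [h])
    refine (Finset.sum_le_sum this).trans ?_
    simp
  -- A hole is at most `m` generations below its cube, so its weight is a fixed fraction of ℓ(Q)^d
  -- or more.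
  have hterm : ∀ Q ∈ A, (ρ ^ m) ^ d * a * Q.side ^ d ≤ w (W Q) := by
    intro Q hQ
    obtain ⟨hWT, -, hWg, -⟩ := hW Q (hA Q hQ).1
    refine le_trans ?_ (hw.lower _ hWT)
    have hs := Q.side_pos hρ
    have : ρ ^ m * Q.side ≤ (W Q).side := by
      have h1 : ρ ^ (Q.gen + m) ≤ ρ ^ (W Q).gen := zpow_le_zpow_right_of_le_one₀ hρ hρ1.le hWg
      rw [zpow_add₀ hρ.ne', zpow_natCast] at h1
      unfold Cube.side
      linarith
    calc _ = a * (ρ ^ m * Q.side) ^ d := by rw [mul_pow]; ring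
      _ ≤ _ := by gcongr
  rw [div_mul_eq_mul_div, le_div_iff₀ (by positivity), mul_comm, Finset.mul_sum]
  refine (Finset.sum_le_sum hterm).trans (hsum.trans ?_)
  rw [mul_assoc]
  exact mul_le_mul_of_nonneg_left (hw.upper P hP) (by positivity)

end Boundary

end ChristDavidCubes

/-! ### Packing of cubes seen from points far from the minimal cubes -/

open Classical in
lemma sum_le_sum_sum_filter {α β : Type*} (A : Finset α) (B : Finset β) (r : β → α → Prop)
    {f : α → ℝ} (hf : ∀ x ∈ A, 0 ≤ f x) (h : ∀ x ∈ A, ∃ b ∈ B, r b x) :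
    ∑ x ∈ A, f x ≤ ∑ b ∈ B, ∑ x ∈ A with r b x, f x := by
  simp only [Finset.sum_filter]
  rw [Finset.sum_comm]
  refine Finset.sum_le_sum fun x hx => ?_
  obtain ⟨b, hb, hbx⟩ := h x hx
  calc f x = if r b x then f x else 0 := by rw [if_pos hbx]
    _ ≤ _ := Finset.single_le_sum (f := fun b => if r b x then f x else 0)
      (fun b _ => by split_ifs; exacts [hf x hx, le_rfl]) hb

namespace ChristDavidCubes

/-- The cubes of a region that are seen, at their own scale, from points with larger distance to
the minimal cubes satisfy a packing condition below every cube of the region. -/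
theorem exists_far_packing (n : ℕ) {ρ : ℝ} (hρ : 0 < ρ) (hρ1 : ρ < 1) (d : ℕ) {a b : ℝ}
    (ha : 0 < a) (hb : 0 < b) {M : ℝ} (hM : 0 < M) :
    ∃ C > 0, ∀ {E : Set (EuclideanSpace ℝ (Fin n))}
      {D : ChristDavidCubes E ρ} {T : Set D.Cube} {T₀ : D.Cube} {w : D.Cube → ℝ},
      IsStoppingTimeRegion T T₀ → T.Finite → IsRegularWeight d a b T w →
      ∀ P ∈ T, ∀ A : Finset D.Cube,
        (∀ Q ∈ A, Q ∈ T ∧ Q ≤ P ∧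
          ∃ y ∈ E, Q.side ≤ distFun (minimalCubes T) y ∧ dist y Q.ctr ≤ M * Q.side) →
        ∑ Q ∈ A, Q.side ^ d ≤ C * P.side ^ d := by
  classical
  obtain ⟨C, hC, hbd⟩ := exists_boundary_packing hρ hρ1 d ha hb hM
  obtain ⟨N, hN⟩ := exists_card_le_of_gen n (M + 2)
  refine ⟨C + b / a * (N * (C + 1)), by positivity, ?_⟩
  intro E D T T₀ w hT hfin hw P hP A hA
  have hpos : ∀ Q : D.Cube, 0 ≤ Q.side ^ d := fun Q => pow_nonneg (Q.side_pos hρ).le d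
  -- Cubes near the complement of `P` are packed already. For the others the point `y` given by the
  -- hypothesis lies in `P`.
  obtain ⟨near, hnear⟩ : ∃ near : D.Cube → Prop, ∀ Q, near Q ↔
    ∃ y ∈ E, y ∉ P.carrier ∧ dist y Q.ctr ≤ M * Q.side := ⟨_, fun _ => Iff.rfl⟩
  rw [← Finset.sum_filter_add_sum_filter_not A near, add_mul]
  refine add_le_add (hbd hT hfin hw P hP _ fun Q hQ => ?_) ?_
  · rw [Finset.mem_filter] at hQ
    exact ⟨(hA Q hQ.1).1, (hA Q hQ.1).2.1, (hnear Q).1 hQ.2⟩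
  set A₂ := A.filter fun Q => ¬ near Q with hA₂
  set F : Finset D.Cube := hfin.toFinset.filter fun Q => Q ∈ minimalCubes T ∧ Q ≤ P with hF
  have hFm : ∀ Q ∈ F, Q ∈ minimalCubes T ∧ Q ≤ P := fun Q hQ => (Finset.mem_filter.1 hQ).2
  have hFsum : ∑ Q ∈ F, Q.side ^ d ≤ b / a * P.side ^ d := by
    rw [div_mul_eq_mul_div, le_div_iff₀ ha, mul_comm, Finset.mul_sum]
    refine (Finset.sum_le_sum fun Q hQ => hw.lower Q (hFm Q hQ).1.1).trans ?_
    refine (hw.sum_le P hP F (fun Q hQ => ⟨(hFm Q hQ).1.1, (hFm Q hQ).2⟩) ?_).trans (hw.upper P hP)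
    exact fun Q hQ R hR hne => disjoint_of_minimal (hFm Q hQ).1 (hFm R hR).1 hne
  obtain ⟨r₁, hr₁⟩ : ∃ r₁ : D.Cube → D.Cube → Prop, ∀ Q₁ Q, r₁ Q₁ Q ↔
    Q₁.gen ≤ Q.gen ∧ ∃ y ∈ E, y ∈ Q₁.carrier ∧ dist y Q.ctr ≤ M * Q.side :=
    ⟨_, fun _ _ => Iff.rfl⟩
  -- Inside a minimal cube `Q₁` the distance function is at most ℓ(Q₁), so the cube `Q` that sees
  -- `y` is no larger than `Q₁`.
  have hstep₁ : ∑ Q ∈ A₂, Q.side ^ d ≤ ∑ Q₁ ∈ F, ∑ Q ∈ A₂ with r₁ Q₁ Q, Q.side ^ d := by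
    refine sum_le_sum_sum_filter _ _ _ (fun Q _ => hpos Q) fun Q hQ => ?_
    rw [hA₂, Finset.mem_filter] at hQ
    obtain ⟨hQT, hQP, y, hyE, hy1, hy2⟩ := hA Q hQ.1
    have hyP : y ∈ P.carrier := by
      by_contra hyP
      exact hQ.2 ((hnear Q).2 ⟨y, hyE, hyP, hy2⟩)
    obtain ⟨Q₁, hQ₁, hyQ₁, hQ₁P⟩ := hT.exists_minimal hfin hρ hP hyP
    refine ⟨Q₁, Finset.mem_filter.2 ⟨hfin.mem_toFinset.2 hQ₁.1, hQ₁, hQ₁P⟩, (hr₁ _ _).2 ⟨?_, y, hyE, hyQ₁, hy2⟩⟩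
    have h1 := distFun_le hρ hQ₁ y
    rw [Metric.infDist_zero_of_mem hyQ₁] at h1
    exact Cube.gen_le_of_side_le hρ hρ1 (by linarith)
  -- `Q` lies in a cube `V` of the generation of `Q₁` close to `Q₁`; there are at most `N` of them.
  -- Below each `V`, boundary packing costs `C`, and at most the single cube `V` is left, which
  -- accounts for the 1.
  have hstep₂ : ∀ Q₁ ∈ F, ∑ Q ∈ A₂ with r₁ Q₁ Q, Q.side ^ d ≤ N * (C + 1) * Q₁.side ^ d := by
    intro Q₁ hQ₁
    have hNb := hN ρ hρ E D Q₁.ctr Q₁.gen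
      {V | V ∈ T ∧ V.gen = Q₁.gen ∧ dist V.ctr Q₁.ctr ≤ (M + 2) * V.side}
      fun V hV => hV.2
    set B := hNb.1.toFinset with hB
    have hBcard : B.card ≤ N := by rw [hB, ← Set.ncard_eq_toFinset_card _ hNb.1]; exact hNb.2
    have h1 : ∑ Q ∈ A₂ with r₁ Q₁ Q, Q.side ^ d ≤
        ∑ V ∈ B, ∑ Q ∈ A₂.filter (r₁ Q₁) with Q ≤ V, Q.side ^ d := by
      refine sum_le_sum_sum_filter _ _ (fun V Q => Q ≤ V) (fun Q _ => hpos Q) fun Q hQ => ?_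
      obtain ⟨hQA₂, hQr⟩ := Finset.mem_filter.1 hQ
      obtain ⟨hg, y, hyE, hyQ₁, hyd⟩ := (hr₁ _ _).1 hQr
      obtain ⟨hQT, hQP, -⟩ := hA Q (Finset.mem_filter.1 hQA₂).1
      obtain ⟨V, hVg, hQV⟩ := Q.exists_ge hρ hg
      have hVP : V ≤ P := Cube.le_of_le_of_le hρ hQV hQP (hVg ▸ (hFm Q₁ hQ₁).2.1)
      refine ⟨V, hNb.1.mem_toFinset.2 ⟨hT.coherent Q hQT V hQV (hVP.trans (hT.greatest.2 hP)),
        hVg, ?_⟩, hQV⟩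
      have hs := Cube.side_eq_of_gen_eq hVg
      have h2 : Q.side ≤ V.side := Cube.side_le_side hρ hρ1.le hQV.1
      have h3 := Q₁.dist_ctr_lt hyQ₁
      have h4 := Cube.dist_ctr_lt_of_le hρ hQV
      have h5 := dist_triangle4 V.ctr Q.ctr y Q₁.ctr
      rw [dist_comm V.ctr Q.ctr, dist_comm Q.ctr y] at h5
      have h6 : M * Q.side ≤ M * V.side := by gcongr
      linarith
    refine h1.trans ?_
    have h2 : ∀ V ∈ B, ∑ Q ∈ A₂.filter (r₁ Q₁) with Q ≤ V, Q.side ^ d ≤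
        (C + 1) * Q₁.side ^ d := by
      intro V hV
      obtain ⟨hVT, hVg, -⟩ := hNb.1.mem_toFinset.1 hV
      rw [← Cube.side_eq_of_gen_eq hVg]
      set A₃ := (A₂.filter (r₁ Q₁)).filter (fun Q => Q ≤ V) with hA₃
      rw [← Finset.sum_filter_add_sum_filter_not A₃
        (fun Q => ∃ y ∈ E, y ∉ V.carrier ∧ dist y Q.ctr ≤ M * Q.side), add_mul, one_mul]
      have hA₃T : ∀ Q ∈ A₃, Q ∈ T := fun Q hQ =>
        (hA Q (Finset.mem_filter.1 (Finset.mem_filter.1 (Finset.mem_filter.1 hQ).1).1).1).1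
      refine add_le_add (hbd hT hfin hw V hVT _ fun Q hQ => ?_) ?_
      · rw [Finset.mem_filter] at hQ
        exact ⟨hA₃T Q hQ.1, (Finset.mem_filter.1 hQ.1).2, hQ.2⟩
      · refine (Finset.sum_le_sum_of_subset_of_nonneg (t := {V}) ?_ fun Q _ _ => hpos Q).trans
          (by simp)
        intro Q hQ
        rw [Finset.mem_filter] at hQ
        rw [Finset.mem_singleton]
        obtain ⟨hQ₃, hQV⟩ := Finset.mem_filter.1 hQ.1
        obtain ⟨-, y, hyE, hyQ₁, hyd⟩ := (hr₁ _ _).1 (Finset.mem_filter.1 hQ₃).2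
        have hyV : y ∈ V.carrier := by
          by_contra hyV
          exact hQ.2 ⟨y, hyE, hyV, hyd⟩
        -- If `Q` is not near the complement of `V`, the point of `Q₁` it sees is in `V`; equal
        -- generations force `V = Q₁`, and minimality forces `Q = Q₁`.
        have hVQ₁ : V = Q₁ := Cube.eq_of_mem hVg.symm hyQ₁ hyV
        rw [hVQ₁] at hQV ⊢
        exact eq_of_le_minimal (hA₃T Q hQ.1) (hFm Q₁ hQ₁).1 hQV
    refine (Finset.sum_le_card_nsmul _ _ _ h2).trans ?_
    rw [nsmul_eq_mul, mul_assoc]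
    have : 0 ≤ (C + 1) * Q₁.side ^ d := mul_nonneg (by linarith) (hpos Q₁)
    gcongr
  refine hstep₁.trans ((Finset.sum_le_sum hstep₂).trans ?_)
  rw [← Finset.mul_sum]
  calc _ ≤ N * (C + 1) * (b / a * P.side ^ d) := by gcongr
    _ = _ := by ring

/-- Packing in balls. -/
theorem exists_far_packing_ball (n : ℕ) {ρ : ℝ} (hρ : 0 < ρ) (hρ1 : ρ < 1) (d : ℕ) {a b : ℝ}
    (ha : 0 < a) (hb : 0 < b) {M : ℝ} (hM : 0 < M) {L : ℝ} (hL : 0 < L) :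
    ∃ C > 0, ∀ {E : Set (EuclideanSpace ℝ (Fin n))}
      {D : ChristDavidCubes E ρ} {T : Set D.Cube} {T₀ : D.Cube} {w : D.Cube → ℝ},
      IsStoppingTimeRegion T T₀ → T.Finite → IsRegularWeight d a b T w →
      ∀ (x : EuclideanSpace ℝ (Fin n)) (r : ℝ), 0 < r → ∀ A : Finset D.Cube,
        (∀ Q ∈ A, Q ∈ T ∧ Q.side ≤ r ∧ dist Q.ctr x ≤ L * r ∧
          ∃ y ∈ E, Q.side ≤ distFun (minimalCubes T) y ∧ dist y Q.ctr ≤ M * Q.side) →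
        ∑ Q ∈ A, Q.side ^ d ≤ C * r ^ d := by
  classical
  obtain ⟨C, hC, hfar⟩ := exists_far_packing n hρ hρ1 d ha hb hM
  obtain ⟨N, hN⟩ := exists_card_le_of_gen n ((L + 1) / ρ)
  refine ⟨(N + 1) * C, by positivity, ?_⟩
  intro E D T T₀ w hT hfin hw x r hr A hA
  have hpos : ∀ Q : D.Cube, 0 ≤ Q.side ^ d := fun Q => pow_nonneg (Q.side_pos hρ).le d
  -- The half-open range of side lengths admits a single generation, so the counting lemma applies.
  set S : Set D.Cube := {P | ρ * r < P.side ∧ P.side ≤ r ∧ dist P.ctr x ≤ (L + 1) * r} with hS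
  have hScard : S.Finite ∧ S.ncard ≤ N := by
    rcases S.eq_empty_or_nonempty with h | ⟨P, hP⟩
    · rw [h]; simp
    refine hN ρ hρ E D x P.gen S fun Q hQ => ⟨?_, ?_⟩
    · have key : ∀ {V V' : D.Cube}, V ∈ S → V' ∈ S → V.gen ≤ V'.gen := by
        intro V V' hV hV'
        by_contra! hlt
        have h1 : ρ ^ V.gen ≤ ρ ^ (V'.gen + 1) := zpow_le_zpow_right_of_le_one₀ hρ hρ1.le (by omega)
        rw [zpow_add_one₀ hρ.ne'] at h1
        have h2 := hV.1
        have h3 := hV'.2.1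
        unfold Cube.side at h2 h3
        have h4 : ρ * (5 * ρ ^ V'.gen) ≤ ρ * r := by gcongr
        linarith
      exact le_antisymm (key hQ hP) (key hP hQ)
    · refine hQ.2.2.trans ?_
      rw [div_mul_eq_mul_div, le_div_iff₀ hρ, mul_assoc, mul_comm r]
      have := hQ.1.le
      gcongr
  -- The largest cube of the region above `Q` with side at most `r` either has a parent larger than
  -- `r`, so it is in `S`, or is the maximal cube, which may be far smaller than `r`.
  set B : Finset D.Cube := insert T₀ hScard.1.toFinset with hB
  have hBcard : B.card ≤ N + 1 := by
    refine (Finset.card_insert_le _ _).trans ?_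
    rw [← Set.ncard_eq_toFinset_card _ hScard.1]
    omega
  obtain ⟨R, hR⟩ : ∃ R : D.Cube → D.Cube → Prop, ∀ P Q, R P Q ↔ P ∈ T ∧ Q ≤ P ∧ P.side ≤ r :=
    ⟨_, fun _ _ => Iff.rfl⟩
  have h1 := sum_le_sum_sum_filter A B R
    (fun Q _ => hpos Q) (fun Q hQ => by
      obtain ⟨hQT, hQr, hQx, -⟩ := hA Q hQ
      obtain ⟨P, ⟨hPT, hQP, hPr⟩, hmin⟩ :=
        (hfin.subset (t := {P | P ∈ T ∧ Q ≤ P ∧ P.side ≤ r}) fun W hW => hW.1).exists_minimalFor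
          (fun Q => Q.gen) _ ⟨Q, hQT, le_rfl, hQr⟩
      refine ⟨P, ?_, (hR _ _).2 ⟨hPT, hQP, hPr⟩⟩
      rw [hB, Finset.mem_insert, hScard.1.mem_toFinset]
      by_cases hPT₀ : P = T₀
      · exact Or.inl hPT₀
      right
      have hlt : P < T₀ := lt_of_le_of_ne (hT.greatest.2 hPT) hPT₀
      have hg := Cube.gen_lt_of_lt hρ hlt
      obtain ⟨V, hVg, hPV⟩ := P.exists_ge hρ (k := P.gen - 1) (by omega)
      have hVT₀ : V ≤ T₀ := Cube.le_of_le_of_le hρ hPV hlt.le (by omega)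
      have hVr : r < V.side := by
        by_contra! hVr
        have h2 : P.gen ≤ V.gen :=
          hmin ⟨hT.coherent P hPT V hPV hVT₀, hQP.trans hPV, hVr⟩ hPV.1
        omega
      refine ⟨?_, hPr, ?_⟩
      · have : P.side = ρ * V.side := by
          rw [Cube.side_eq_mul hρ (Q := P) (R := V) (m := 1) (by rw [hVg]; simp), pow_one]
        rw [this]
        gcongr
      · have h2 := Cube.dist_ctr_lt_of_le hρ hQP
        have h3 := dist_triangle_left P.ctr x Q.ctr
        linarith)
  refine h1.trans ?_
  have h2 : ∀ P ∈ B, ∑ Q ∈ A with R P Q, Q.side ^ d ≤ C * r ^ d := by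
    intro P _
    by_cases hP : P ∈ T ∧ P.side ≤ r
    · refine (hfar hT hfin hw P hP.1 _ fun Q hQ => ?_).trans ?_
      · have hQA := (Finset.mem_filter.1 hQ).1
        have hQP := ((hR _ _).1 (Finset.mem_filter.1 hQ).2).2.1
        exact ⟨(hA Q hQA).1, hQP, (hA Q hQA).2.2.2⟩
      · have := P.side_pos hρ
        have := hP.2
        gcongr
    · rw [Finset.sum_eq_zero]
      · positivity
      · intro Q hQ
        obtain ⟨h1, -, h2⟩ := (hR _ _).1 (Finset.mem_filter.1 hQ).2
        exact absurd ⟨h1, h2⟩ hP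
  refine (Finset.sum_le_card_nsmul _ _ _ h2).trans ?_
  rw [nsmul_eq_mul, mul_assoc]
  have : 0 ≤ C * r ^ d := by positivity
  gcongr
  exact_mod_cast hBcard

end ChristDavidCubes

/-! ### Dyadic cubes and Whitney families -/

namespace DyadicCube

variable {n : ℕ}

/-- The closed dyadic cube. -/
def closedCarrier (I : DyadicCube n) : Set (EuclideanSpace ℝ (Fin n)) :=
  {x | ∀ i, x i ∈ Set.Icc (I.index i * I.side) ((I.index i + 1) * I.side)}

lemma side_pos (I : DyadicCube n) : 0 < I.side := by unfold side; positivity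

lemma carrier_subset_closedCarrier (I : DyadicCube n) : I.carrier ⊆ I.closedCarrier :=
  fun _ hx i => Set.Ico_subset_Icc_self (hx i)

lemma skeleton_subset_closedCarrier (d : ℕ) (I : DyadicCube n) :
    I.skeleton d ⊆ I.closedCarrier := by
  rintro x ⟨s, -, h1, h2⟩ i
  have hs := I.side_pos
  by_cases hi : i ∈ s
  · exact h1 i hi
  · rcases h2 i hi with h | h <;> rw [h] <;> constructor <;> linarith

lemma dist_le_of_mem_closedCarrier {I : DyadicCube n} {x y : EuclideanSpace ℝ (Fin n)}
    (hx : x ∈ I.closedCarrier) (hy : y ∈ I.closedCarrier) : dist x y ≤ n * I.side := by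
  refine EuclideanSpace.dist_le_mul fun i => ?_
  obtain ⟨h1, h2⟩ := hx i
  obtain ⟨h3, h4⟩ := hy i
  rw [abs_le]
  constructor <;> linarith

/-- The dyadic cube of scale `k` containing `x`. -/
noncomputable def containing (k : ℤ) (x : EuclideanSpace ℝ (Fin n)) : DyadicCube n where
  scale := k
  index i := ⌊x i * 2 ^ k⌋

lemma side_containing (k : ℤ) (x : EuclideanSpace ℝ (Fin n)) :
    (containing k x).side = 2 ^ (-k) := rfl

lemma mem_carrier_iff {I : DyadicCube n} {x : EuclideanSpace ℝ (Fin n)} :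
    x ∈ I.carrier ↔ ∀ i, ⌊x i * 2 ^ I.scale⌋ = I.index i := by
  refine forall_congr' fun i => ?_
  have h : (0 : ℝ) < 2 ^ I.scale := by positivity
  rw [Int.floor_eq_iff, Set.mem_Ico, side, zpow_neg, ← div_eq_mul_inv, ← div_eq_mul_inv,
    div_le_iff₀ h, lt_div_iff₀ h]

lemma mem_containing (k : ℤ) (x : EuclideanSpace ℝ (Fin n)) : x ∈ (containing k x).carrier :=
  mem_carrier_iff.2 fun _ => rfl

lemma containing_eq_of_mem {j k : ℤ} (hjk : j ≤ k) {x y : EuclideanSpace ℝ (Fin n)}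
    (h : y ∈ (containing k x).carrier) : containing j y = containing j x := by
  have key : ∀ u v : ℝ, ⌊u * 2 ^ k⌋ = ⌊v * 2 ^ k⌋ → ⌊u * 2 ^ j⌋ = ⌊v * 2 ^ j⌋ := by
    intro u v huv
    obtain ⟨m, rfl⟩ : ∃ m : ℕ, k = j + m := ⟨(k - j).toNat, by omega⟩
    rw [Int.floor_eq_iff]
    have hN : (0 : ℝ) < 2 ^ m := by positivity
    have e : ∀ t : ℝ, t * 2 ^ (j + m : ℤ) = t * 2 ^ j * 2 ^ m := fun t => by
      rw [zpow_add₀ two_ne_zero, zpow_natCast]; ring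
    rw [e, e] at huv
    have h1 := Int.floor_le (v * 2 ^ j)
    have h2 := Int.lt_floor_add_one (v * 2 ^ j)
    set q := ⌊v * 2 ^ j⌋ with hq
    constructor
    · have h3 : q * 2 ^ m ≤ ⌊v * 2 ^ j * 2 ^ m⌋ := by
        rw [Int.le_floor]; push_cast; gcongr
      rw [← huv, Int.le_floor] at h3
      push_cast at h3
      exact le_of_mul_le_mul_right h3 hN
    · have h3 : ⌊v * 2 ^ j * 2 ^ m⌋ < (q + 1) * 2 ^ m := by
        rw [Int.floor_lt]; push_cast; gcongr
      rw [← huv, Int.floor_lt] at h3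
      push_cast at h3
      exact lt_of_mul_lt_mul_right h3 hN.le
  unfold containing
  congr 1
  funext i
  exact key _ _ (mem_carrier_iff.1 h i)

lemma carrier_containing_subset {j k : ℤ} (hjk : j ≤ k) (x : EuclideanSpace ℝ (Fin n)) :
    (containing k x).carrier ⊆ (containing j x).carrier := fun y hy => by
  rw [← containing_eq_of_mem hjk hy]; exact mem_containing j y

/-- Whitney decomposition with respect to a `1`-Lipschitz positive function. -/
theorem exists_whitney {φ : EuclideanSpace ℝ (Fin n) → ℝ} (hφ : ∀ x y, φ x ≤ φ y + dist x y)
    {ε : ℝ} (hε : 0 < ε) (hφε : ∀ x, ε ≤ φ x) {lam : ℝ} (hlam : 0 < lam) (hnlam : n * lam ≤ 1)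
    (G : Set (EuclideanSpace ℝ (Fin n))) :
    ∃ 𝒞 : Set (DyadicCube n), 𝒞.PairwiseDisjoint carrier ∧ G ⊆ (⋃ I ∈ 𝒞, I.carrier) ∧
      ∀ I ∈ 𝒞, (∃ y ∈ G, y ∈ I.carrier) ∧
        ∀ x ∈ I.carrier, I.side ≤ lam * φ x ∧ lam * φ x ≤ 4 * I.side := by
  -- The smallest good scale index gives the largest good cube through `y`. Good indices are bounded
  -- below because φ(y) is finite, and exist because φ ≥ ε.
  obtain ⟨Good, hGood⟩ : ∃ Good : EuclideanSpace ℝ (Fin n) → ℤ → Prop, ∀ y k, Good y k ↔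
      ∀ x ∈ (containing k y).carrier, (2 : ℝ) ^ (-k) ≤ lam * φ x := ⟨_, fun _ _ => Iff.rfl⟩
  have hex : ∀ y, ∃ k, Good y k ∧ ∀ j, Good y j → k ≤ j := by
    intro y
    have h1 : ∃ b : ℤ, ∀ z, Good y z → b ≤ z := by
      obtain ⟨m, hm⟩ := pow_unbounded_of_one_lt (lam * φ y) one_lt_two
      refine ⟨-m, fun k hk => ?_⟩
      have h2 := (hGood y k).1 hk y (mem_containing k y)
      have h3 : (2 : ℝ) ^ (-k) < 2 ^ (m : ℤ) := by rw [zpow_natCast]; exact h2.trans_lt hm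
      have := (zpow_lt_zpow_iff_right₀ one_lt_two).1 h3
      omega
    have h2 : ∃ k : ℤ, Good y k := by
      obtain ⟨m, hm⟩ := exists_pow_lt_of_lt_one (mul_pos hlam hε) (by norm_num : (1 / 2 : ℝ) < 1)
      refine ⟨m, (hGood y m).2 fun x _ => ?_⟩
      rw [zpow_neg, zpow_natCast, ← inv_pow, ← one_div]
      refine hm.le.trans ?_
      gcongr
      exact hφε x
    exact Int.exists_least_of_bdd h1 h2
  choose k hk hmin using hex
  refine ⟨(fun y => containing (k y) y) '' G, ?_, ?_, ?_⟩
  · rintro _ ⟨y, -, rfl⟩ _ ⟨y', -, rfl⟩ hne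
    rw [Function.onFun, Set.disjoint_left]
    intro z hz hz'
    apply hne
    wlog h : k y ≤ k y' generalizing y y'
    · exact (this y' y hne.symm hz' hz (by omega)).symm
    have e1 := containing_eq_of_mem le_rfl hz
    have e2 := containing_eq_of_mem h hz'
    have e3 : containing (k y) y' = containing (k y) y := e2.symm.trans e1
    have h1 : k y' ≤ k y := by
      apply hmin
      rw [hGood, e3]
      exact (hGood _ _).1 (hk y)
    have h2 : k y' = k y := le_antisymm h1 h
    show containing (k y) y = containing (k y') y'
    rw [h2, e3]
  · intro y hy
    simp only [Set.mem_iUnion]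
    exact ⟨_, ⟨y, hy, rfl⟩, mem_containing _ _⟩
  · rintro _ ⟨y, hy, rfl⟩
    refine ⟨⟨y, hy, mem_containing _ _⟩, fun x hx => ⟨(hGood _ _).1 (hk y) x hx, ?_⟩⟩
    -- The dyadic parent fails at some point of it; the Lipschitz bound carries the reverse
    -- inequality to all points of the cube, and `n * lam ≤ 1` turns the factor 2 into 4.
    have h1 : ¬ Good y (k y - 1) := fun h => by have := hmin y _ h; omega
    rw [hGood] at h1
    push Not at h1
    obtain ⟨x', hx', hlt⟩ := h1
    have h2 : (2 : ℝ) ^ (-(k y - 1)) = 2 * 2 ^ (-k y) := by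
      rw [neg_sub, sub_eq_add_neg, zpow_add₀ two_ne_zero, zpow_one]
    have h3 := dist_le_of_mem_closedCarrier
      (carrier_subset_closedCarrier _ (carrier_containing_subset (by omega : k y - 1 ≤ k y) y hx))
      (carrier_subset_closedCarrier _ hx')
    rw [side_containing, h2] at h3
    rw [h2] at hlt
    rw [side_containing]
    have h4 : (0 : ℝ) < 2 ^ (-k y) := by positivity
    have h5 : lam * φ x ≤ lam * (φ x' + n * (2 * 2 ^ (-k y))) := by
      gcongr
      linarith [hφ x x']
    have h6 : n * lam * (2 * 2 ^ (-k y)) ≤ 1 * (2 * 2 ^ (-k y) : ℝ) := by gcongr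
    linarith

/-- Disjoint dyadic cubes that are large and near a point are boundedly many. -/
theorem exists_card_le (n : ℕ) (L : ℝ) : ∃ N : ℕ, ∀ s : ℝ, 0 < s →
    ∀ (x : EuclideanSpace ℝ (Fin n)) (𝒞 : Set (DyadicCube n)), 𝒞.PairwiseDisjoint carrier →
      (∀ I ∈ 𝒞, s ≤ I.side ∧ ∃ p ∈ I.closedCarrier, dist p x ≤ L * s) →
      𝒞.Finite ∧ 𝒞.ncard ≤ N := by
  obtain ⟨N, hN⟩ := exists_card_le_of_separated n (n / 2 + L)
  refine ⟨N, fun s hs x 𝒞 hdisj h𝒞 => ?_⟩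
  have hex : ∀ I : DyadicCube n, ∃ q : EuclideanSpace ℝ (Fin n), I ∈ 𝒞 →
      dist q x ≤ (n / 2 + L) * s ∧
      ∀ z : EuclideanSpace ℝ (Fin n), (∀ i, |z i - q i| < s / 2) → z ∈ I.carrier := by
    intro I
    by_cases hI : I ∈ 𝒞
    swap
    · exact ⟨0, fun h => absurd h hI⟩
    obtain ⟨hside, p, hp, hpx⟩ := h𝒞 I hI
    -- Clamping the coordinates of `p` to keep distance s/2 from the faces costs at most n s/2. The
    -- resulting points are `s`-separated: the midpoint of two closer ones would lie in both
    -- disjoint cubes.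
    refine ⟨WithLp.toLp 2 fun i =>
      max (I.index i * I.side + s / 2) (min ((I.index i + 1) * I.side - s / 2) (p i)),
      fun _ => ⟨?_, ?_⟩⟩
    · refine (dist_triangle _ p x).trans ?_
      have : dist (WithLp.toLp 2 fun i => max (I.index i * I.side + s / 2)
          (min ((I.index i + 1) * I.side - s / 2) (p i))) p ≤ n * (s / 2) := by
        refine EuclideanSpace.dist_le_mul fun i => ?_
        obtain ⟨h1, h2⟩ := hp i
        dsimp only
        rw [abs_le]
        constructor
        · have := le_max_right (I.index i * I.side + s / 2)
            (min ((I.index i + 1) * I.side - s / 2) (p i))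
          have h3 : p i - s / 2 ≤ min ((I.index i + 1) * I.side - s / 2) (p i) :=
            le_min (by linarith) (by linarith)
          linarith
        · have h3 : max (I.index i * I.side + s / 2)
            (min ((I.index i + 1) * I.side - s / 2) (p i)) ≤ p i + s / 2 :=
            max_le (by linarith) ((min_le_right _ _).trans (by linarith))
          linarith
      linarith
    · intro z hz i
      have h1 := abs_lt.1 (hz i)
      dsimp only at h1
      have h2 := le_max_left (I.index i * I.side + s / 2)
        (min ((I.index i + 1) * I.side - s / 2) (p i))
      have h3 : max (I.index i * I.side + s / 2)
          (min ((I.index i + 1) * I.side - s / 2) (p i)) ≤ (I.index i + 1) * I.side - s / 2 :=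
        max_le (by linarith) (min_le_left _ _)
      constructor <;> linarith
  choose q hq using hex
  have hqI : ∀ I ∈ 𝒞, q I ∈ I.carrier := fun I hI =>
    (hq I hI).2 _ fun i => by rw [sub_self, abs_zero]; positivity
  have hinj : Set.InjOn q 𝒞 := by
    intro I hI J hJ h
    by_contra hne
    exact Set.disjoint_left.1 (hdisj hI hJ hne) (hqI I hI) (h ▸ hqI J hJ)
  have := hN s hs x (q '' 𝒞) (by rintro _ ⟨I, hI, rfl⟩; exact (hq I hI).1) (by
    rintro _ ⟨I, hI, rfl⟩ _ ⟨J, hJ, rfl⟩ hne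
    by_contra! hlt
    have hmid : ∀ i, |(q I i + q J i) / 2 - q I i| < s / 2 ∧
        |(q I i + q J i) / 2 - q J i| < s / 2 := fun i => by
      have h1 := abs_lt.1 ((EuclideanSpace.abs_sub_le_dist (q I) (q J) i).trans_lt hlt)
      constructor <;> rw [abs_lt] <;> constructor <;> linarith
    have h1 : WithLp.toLp 2 (fun i => (q I i + q J i) / 2) ∈ I.carrier :=
      (hq I hI).2 _ fun i => (hmid i).1
    have h2 : WithLp.toLp 2 (fun i => (q I i + q J i) / 2) ∈ J.carrier :=
      (hq J hJ).2 _ fun i => (hmid i).2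
    exact Set.disjoint_left.1 (hdisj hI hJ fun h => hne (by rw [h])) h1 h2)
  exact ⟨this.1.of_finite_image hinj, by rw [← hinj.ncard_image]; exact this.2⟩

end DyadicCube

/-! ### Hausdorff measure and coordinate planes -/

section Projections

variable {n : ℕ}

/-- Coordinate projection is 1-Lipschitz into the sup norm, where Hausdorff measure of full
dimension is Lebesgue measure. All lower bounds for faces come from here. -/
lemma volume_image_restrict_le (s : Finset (Fin n)) (A : Set (EuclideanSpace ℝ (Fin n))) :
    MeasureTheory.volume ((fun (x : EuclideanSpace ℝ (Fin n)) (i : s) => x i) '' A)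
      ≤ μH[(s.card : ℝ)] A := by
  have h1 : LipschitzWith 1 (fun (x : EuclideanSpace ℝ (Fin n)) (i : s) => x i) := by
    refine LipschitzWith.of_dist_le_mul fun x y => ?_
    rw [NNReal.coe_one, one_mul, dist_pi_le_iff dist_nonneg]
    exact fun i => EuclideanSpace.abs_sub_le_dist x y i
  have h2 := h1.hausdorffMeasure_image_le (Nat.cast_nonneg s.card) A
  rw [ENNReal.coe_one, ENNReal.one_rpow, one_mul] at h2
  rw [← MeasureTheory.hausdorffMeasure_pi_real, Fintype.card_coe]
  exact h2

/-- The Hausdorff measure of the part of a coordinate plane in a ball. -/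
lemma hausdorffMeasure_plane_inter_ball_le (s : Finset (Fin n)) (v : Fin n → ℝ)
    (x : EuclideanSpace ℝ (Fin n)) {r : ℝ} (hr : 0 ≤ r) :
    μH[(s.card : ℝ)] ({z : EuclideanSpace ℝ (Fin n) | ∀ i ∉ s, z i = v i} ∩ Metric.ball x r)
      ≤ ENNReal.ofReal ((n * (2 * r)) ^ s.card) := by
  classical
  let f : (s → ℝ) → EuclideanSpace ℝ (Fin n) := fun u =>
    WithLp.toLp 2 fun i => if h : i ∈ s then u ⟨i, h⟩ else v i
  have hf : LipschitzWith n f := by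
    refine LipschitzWith.of_dist_le_mul fun u u' => ?_
    refine EuclideanSpace.dist_le_mul fun i => ?_
    by_cases h : i ∈ s
    · simpa [f, h, Real.dist_eq] using dist_le_pi_dist u u' ⟨i, h⟩
    · simp [f, h]
  have hsub : {z : EuclideanSpace ℝ (Fin n) | ∀ i ∉ s, z i = v i} ∩ Metric.ball x r ⊆
      f '' Metric.closedBall (fun i : s => x i) r := by
    rintro z ⟨hz, hzx⟩
    refine ⟨fun i => z i, ?_, ?_⟩
    · rw [Metric.mem_closedBall, dist_pi_le_iff hr]
      exact fun i => (EuclideanSpace.abs_sub_le_dist z x i).trans (Metric.mem_ball.1 hzx).le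
    · ext i
      by_cases h : i ∈ s
      · simp [f, h]
      · simp [f, h, hz i h]
  refine (MeasureTheory.measure_mono hsub).trans ?_
  refine (hf.hausdorffMeasure_image_le (Nat.cast_nonneg s.card) _).trans ?_
  have h1 : (μH[(s.card : ℝ)] : MeasureTheory.Measure (s → ℝ)) = MeasureTheory.volume := by
    rw [← MeasureTheory.hausdorffMeasure_pi_real, Fintype.card_coe]
  rw [h1, Real.volume_pi_closedBall _ hr, Fintype.card_coe, ENNReal.rpow_natCast, mul_pow (n : ℝ),
    ENNReal.ofReal_mul (by positivity), ENNReal.ofReal_pow (Nat.cast_nonneg n)]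
  simp

end Projections

/-! ### Measure of skeletons and faces -/

namespace DyadicCube

variable {n : ℕ}

/-- The skeleton is upper regular at all scales. -/
theorem exists_hausdorffMeasure_skeleton_le (n d : ℕ) : ∃ C > 0, ∀ (I : DyadicCube n)
    (x : EuclideanSpace ℝ (Fin n)) (r : ℝ), 0 ≤ r →
      μH[(d : ℝ)] (I.skeleton d ∩ Metric.ball x r) ≤ ENNReal.ofReal (C * r ^ d) := by
  classical
  -- The skeleton lies in the coordinate planes given by a set of `d` free coordinates and a choice
  -- of endpoints; their number depends on `n` and `d` only.
  let J := (Finset.univ.filter fun s : Finset (Fin n) => s.card = d) ×ˢ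
    (Finset.univ : Finset (Fin n → Bool))
  refine ⟨J.card * (n * 2) ^ d + 1, by positivity, fun I x r hr => ?_⟩
  let v : (Fin n → Bool) → Fin n → ℝ := fun e i =>
    if e i then I.index i * I.side else (I.index i + 1) * I.side
  have hsub : I.skeleton d ∩ Metric.ball x r ⊆ ⋃ p ∈ J,
      {z : EuclideanSpace ℝ (Fin n) | ∀ i ∉ p.1, z i = v p.2 i} ∩ Metric.ball x r := by
    rintro z ⟨⟨s, hs, -, hz⟩, hzx⟩
    simp only [Set.mem_iUnion]
    refine ⟨⟨s, fun i => decide (z i = I.index i * I.side)⟩, ?_, fun i hi => ?_, hzx⟩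
    · simp [J, hs]
    · rcases hz i hi with h | h
      · simp [v, h]
      · by_cases h' : z i = I.index i * I.side
        · simp [v, h']
        · simp only [v, h', decide_false, Bool.false_eq_true, if_false]
          exact h
  refine (MeasureTheory.measure_mono hsub).trans
    ((MeasureTheory.measure_biUnion_finset_le _ _).trans ?_)
  have hterm : ∀ p ∈ J, μH[(d : ℝ)] ({z : EuclideanSpace ℝ (Fin n) | ∀ i ∉ p.1, z i = v p.2 i} ∩
      Metric.ball x r) ≤ ENNReal.ofReal ((n * (2 * r)) ^ d) := by
    intro p hp
    have hpd : p.1.card = d := by simpa [J] using hp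
    rw [← hpd]
    exact hausdorffMeasure_plane_inter_ball_le p.1 _ x hr
  refine (Finset.sum_le_card_nsmul _ _ _ hterm).trans ?_
  rw [nsmul_eq_mul, ← ENNReal.ofReal_natCast, ← ENNReal.ofReal_mul (by positivity)]
  refine ENNReal.ofReal_le_ofReal ?_
  have : 0 ≤ r ^ d := by positivity
  rw [← mul_assoc (n : ℝ), mul_pow]
  linarith

lemma exists_Icc_subset {a b t δ : ℝ} (ht : t ∈ Set.Icc a b) (hδ : 0 < δ) (hab : δ ≤ b - a) :
    ∃ l, ∀ u ∈ Set.Icc l (l + δ / 2), u ∈ Set.Icc a b ∧ |u - t| < δ := by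
  rcases le_total t (b - δ / 2) with h | h
  · refine ⟨t, fun u hu => ⟨⟨ht.1.trans hu.1, hu.2.trans (by linarith)⟩, ?_⟩⟩
    rw [abs_lt]; constructor <;> linarith [hu.1, hu.2]
  · refine ⟨t - δ / 2, fun u hu => ⟨⟨?_, ?_⟩, ?_⟩⟩
    · linarith [hu.1]
    · linarith [hu.2, ht.2]
    · rw [abs_lt]; constructor <;> linarith [hu.1, hu.2]

/-- Projecting a face through `x` onto its free coordinates, the part in the ball covers a box of
side δ/2 with δ = r/(n+1), even when `x` is at an end of the face: each interval may be placed on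
either side of `x`. -/
lemma le_hausdorffMeasure_skeleton {d : ℕ} {I : DyadicCube n} {x : EuclideanSpace ℝ (Fin n)}
    (hx : x ∈ I.skeleton d) {r : ℝ} (hr : 0 < r) (hrI : r ≤ I.side) :
    ENNReal.ofReal ((r / (2 * (n + 1))) ^ d) ≤
      μH[(d : ℝ)] (I.skeleton d ∩ Metric.ball x r) := by
  classical
  obtain ⟨s, hs, hx1, hx2⟩ := hx
  set δ : ℝ := r / (n + 1) with hδ
  have hδ0 : 0 < δ := by positivity
  have hδr : δ * (n + 1) = r := by rw [hδ]; field_simp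
  have hδI : δ ≤ I.side := by
    refine le_trans ?_ hrI
    rw [hδ]
    exact div_le_self hr.le (by linarith [(Nat.cast_nonneg n : (0 : ℝ) ≤ n)])
  have hex : ∀ i : Fin n, ∃ l : ℝ, i ∈ s → ∀ u ∈ Set.Icc l (l + δ / 2),
      u ∈ Set.Icc (I.index i * I.side) ((I.index i + 1) * I.side) ∧ |u - x i| < δ := fun i => by
    by_cases hi : i ∈ s
    · obtain ⟨l, hl⟩ := exists_Icc_subset (hx1 i hi) hδ0 (by linarith)
      exact ⟨l, fun _ => hl⟩
    · exact ⟨0, fun h => absurd h hi⟩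
  choose l hl using hex
  have hsub : Set.pi Set.univ (fun i : s => Set.Icc (l i) (l i + δ / 2)) ⊆
      (fun (x : EuclideanSpace ℝ (Fin n)) (i : s) => x i) '' (I.skeleton d ∩ Metric.ball x r) := by
    intro u hu
    refine ⟨WithLp.toLp 2 fun i => if h : i ∈ s then u ⟨i, h⟩ else x i, ⟨⟨s, hs, ?_, ?_⟩, ?_⟩, ?_⟩
    · intro i hi
      simp only [hi, dite_true]
      exact (hl i hi _ (hu ⟨i, hi⟩ trivial)).1
    · intro i hi
      simp only [hi, dite_false]
      exact hx2 i hi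
    · rw [Metric.mem_ball]
      refine (EuclideanSpace.dist_le_mul (r := δ) fun i => ?_).trans_lt (by linarith)
      by_cases hi : i ∈ s
      · simp only [hi, dite_true]
        exact (hl i hi _ (hu ⟨i, hi⟩ trivial)).2.le
      · simp only [hi, dite_false, sub_self, abs_zero]
        exact hδ0.le
    · funext i
      simp
  have h1 := (MeasureTheory.measure_mono hsub).trans (volume_image_restrict_le s _)
  rw [← hs]
  rw [hs] at h1 ⊢
  refine le_trans (le_of_eq ?_) h1
  rw [MeasureTheory.volume_pi_pi]
  simp only [Real.volume_Icc, add_sub_cancel_left, Finset.prod_const, Finset.card_univ,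
    Fintype.card_coe, hs]
  rw [← ENNReal.ofReal_pow (by positivity), hδ, div_div, mul_comm (2 : ℝ)]

/-- The half-open lower face with free coordinates `s`. -/
def lowerFace (s : Finset (Fin n)) (I : DyadicCube n) : Set (EuclideanSpace ℝ (Fin n)) :=
  {x | x ∈ I.carrier ∧ ∀ i ∉ s, x i = I.index i * I.side}

lemma lowerFace_subset_skeleton (s : Finset (Fin n)) (I : DyadicCube n) :
    I.lowerFace s ⊆ I.skeleton s.card :=
  fun _ hx => ⟨s, rfl, fun i _ => Set.Ico_subset_Icc_self (hx.1 i), fun i hi => Or.inl (hx.2 i hi)⟩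

lemma measurableSet_lowerFace (s : Finset (Fin n)) (I : DyadicCube n) :
    MeasurableSet (I.lowerFace s) := by
  have : I.lowerFace s = (⋂ i, {x : EuclideanSpace ℝ (Fin n) |
      x i ∈ Set.Ico (I.index i * I.side) ((I.index i + 1) * I.side)}) ∩
      ⋂ i, ⋂ (_ : i ∉ s), {x : EuclideanSpace ℝ (Fin n) | x i ∈ ({I.index i * I.side} : Set ℝ)} := by
    ext x
    simp [lowerFace, carrier]
  have hm : ∀ i, Measurable fun x : EuclideanSpace ℝ (Fin n) => x i := fun i => by fun_prop
  rw [this]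
  refine (MeasurableSet.iInter fun i => hm i measurableSet_Ico).inter
    (MeasurableSet.iInter fun i => MeasurableSet.iInter fun _ => hm i (measurableSet_singleton _))

lemma le_hausdorffMeasure_lowerFace (s : Finset (Fin n)) (I : DyadicCube n) :
    ENNReal.ofReal (I.side ^ s.card) ≤ μH[(s.card : ℝ)] (I.lowerFace s) := by
  classical
  have hs := I.side_pos
  have hsub : Set.pi Set.univ (fun i : s => Set.Ico (I.index i * I.side)
      ((I.index i + 1) * I.side)) ⊆
      (fun (x : EuclideanSpace ℝ (Fin n)) (i : s) => x i) '' I.lowerFace s := by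
    intro u hu
    refine ⟨WithLp.toLp 2 fun i => if h : i ∈ s then u ⟨i, h⟩ else I.index i * I.side,
      ⟨fun i => ?_, fun i hi => by simp [hi]⟩, by funext i; simp⟩
    by_cases hi : i ∈ s
    · simp only [hi, dite_true]
      exact hu ⟨i, hi⟩ trivial
    · simp only [hi, dite_false]
      exact ⟨le_rfl, by linarith⟩
  refine le_trans (le_of_eq ?_) ((MeasureTheory.measure_mono hsub).trans
    (volume_image_restrict_le s _))
  rw [MeasureTheory.volume_pi_pi]
  have : ∀ i : Fin n, ((I.index i : ℝ) + 1) * I.side - I.index i * I.side = I.side :=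
    fun i => by ring
  simp only [Real.volume_Ico, this, Finset.prod_const, Finset.card_univ, Fintype.card_coe]
  rw [← ENNReal.ofReal_pow hs.le]

end DyadicCube

/-- The properties of a Whitney family of dyadic cubes meeting `G`, with respect to the function
`φ` and the scaling factor `lam`. -/
structure IsWhitneyFamily {n : ℕ} (φ : EuclideanSpace ℝ (Fin n) → ℝ) (lam : ℝ)
    (G : Set (EuclideanSpace ℝ (Fin n))) (𝒞 : Set (DyadicCube n)) : Prop where
  disjoint : 𝒞.PairwiseDisjoint DyadicCube.carrier
  cover : G ⊆ ⋃ I ∈ 𝒞, I.carrier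
  meets : ∀ I ∈ 𝒞, ∃ y ∈ G, y ∈ I.carrier
  side_le : ∀ I ∈ 𝒞, ∀ x ∈ I.carrier, I.side ≤ lam * φ x
  le_side : ∀ I ∈ 𝒞, ∀ x ∈ I.carrier, lam * φ x ≤ 4 * I.side

namespace ChristDavidCubes

/-! ### Charging points to cubes of the region -/

section Charging

variable {X : Type*} [MetricSpace X] [MeasurableSpace X] [BorelSpace X] {E : Set X} {ρ : ℝ}
  {D : ChristDavidCubes E ρ} {T : Set D.Cube} {T₀ : D.Cube}

lemma IsStoppingTimeRegion.distFun_le_of_mem (hT : IsStoppingTimeRegion T T₀) (hfin : T.Finite)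
    (hρ : 0 < ρ) (hρ1 : ρ < 1) {lam : ℝ} {y : X} (hy : y ∈ T₀.dilatedBall lam) :
    distFun (minimalCubes T) y ≤ (lam + 2) * T₀.side := by
  obtain ⟨Q, hQ⟩ := hT.minimalCubes_nonempty hfin hρ
  have h1 := distFun_le hρ hQ y
  have h2 := Q.infDist_le hρ y
  have hQT₀ := hT.greatest.2 hQ.1
  have h3 := Cube.dist_ctr_lt_of_le hρ hQT₀
  have h4 : Q.side ≤ T₀.side := Cube.side_le_side hρ hρ1.le hQT₀.1
  have h5 : dist y T₀.ctr < lam * T₀.side := hy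
  have h6 := dist_triangle_right y Q.ctr T₀.ctr
  linarith

/-- Every point near the maximal cube is seen by a cube of the region whose side length is
comparable to the distance to the minimal cubes. -/
lemma IsStoppingTimeRegion.exists_charge (hT : IsStoppingTimeRegion T T₀) (hfin : T.Finite)
    (hρ : 0 < ρ) (hρ1 : ρ < 1) {lam : ℝ} (hlam : 0 < lam) {y : X}
    (hy : y ∈ T₀.dilatedBall lam) :
    ∃ Q ∈ T, Q.side ≤ distFun (minimalCubes T) y ∧
      distFun (minimalCubes T) y ≤ (lam + 2 + 1 / ρ) * Q.side ∧
      dist y Q.ctr ≤ (lam + 3 + 1 / ρ) * Q.side := by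
  obtain ⟨Q₁, hQ₁, hQ₁e⟩ := exists_distFun_eq (hfin.subset minimalCubes_subset)
    (hT.minimalCubes_nonempty hfin hρ) y
  set s := distFun (minimalCubes T) y with hs
  have hi : 0 ≤ Metric.infDist y Q₁.carrier := Metric.infDist_nonneg
  -- The largest cube of the region above the nearest minimal cube with side at most `s`. Either its
  -- parent is larger than `s`, which costs 1/ρ, or it is the maximal cube, where `s` is at most
  -- (lam + 2) ℓ(T₀).
  obtain ⟨Q, ⟨hQT, hQ₁Q, hQs⟩, hmin⟩ :=
    (hfin.subset (t := {P | P ∈ T ∧ Q₁ ≤ P ∧ P.side ≤ s}) fun W hW => hW.1).exists_minimalFor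
      (fun Q => Q.gen) _ ⟨Q₁, hQ₁.1, le_rfl, by linarith⟩
  have hpos := Q.side_pos hρ
  have hle : s ≤ (lam + 2 + 1 / ρ) * Q.side := by
    by_cases hQT₀ : Q = T₀
    · have h1 : s ≤ (lam + 2) * Q.side := hQT₀ ▸ hT.distFun_le_of_mem hfin hρ hρ1 hy
      have h2 : 0 ≤ 1 / ρ * Q.side := by positivity
      linarith
    · have hlt : Q < T₀ := lt_of_le_of_ne (hT.greatest.2 hQT) hQT₀
      have hg := Cube.gen_lt_of_lt hρ hlt
      obtain ⟨V, hVg, hQV⟩ := Q.exists_ge hρ (k := Q.gen - 1) (by omega)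
      have hVT₀ : V ≤ T₀ := Cube.le_of_le_of_le hρ hQV hlt.le (by omega)
      have hVs : s < V.side := by
        by_contra! hVs
        have h2 : Q.gen ≤ V.gen :=
          hmin ⟨hT.coherent Q hQT V hQV hVT₀, hQ₁Q.trans hQV, hVs⟩ hQV.1
        omega
      have h3 : Q.side = ρ * V.side := by
        rw [Cube.side_eq_mul hρ (Q := Q) (R := V) (m := 1) (by rw [hVg]; simp), pow_one]
      have h4 : V.side = 1 / ρ * Q.side := by rw [h3]; field_simp
      have h5 : 0 ≤ (lam + 2) * Q.side := by positivity
      linarith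
  refine ⟨Q, hQT, hQs, hle, ?_⟩
  have h1 := Q.dist_ctr_le_infDist hρ y
  have h2 : Metric.infDist y Q.carrier ≤ Metric.infDist y Q₁.carrier :=
    Metric.infDist_le_infDist_of_subset hQ₁Q.2 ⟨_, Q₁.ctr_mem hρ⟩
  have h3 := Q₁.side_pos hρ
  linarith

end Charging

/-! ### Whitney families of a region and upper regularity -/

section Whitney

variable {n : ℕ} {ρ : ℝ} {E : Set (EuclideanSpace ℝ (Fin n))} {D : ChristDavidCubes E ρ}
  {T : Set D.Cube} {T₀ : D.Cube} {lam C₀ : ℝ} {𝒞 : Set (DyadicCube n)}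

lemma exists_whitneyFamily (hρ : 0 < ρ) (hfin : T.Finite) (hT : IsStoppingTimeRegion T T₀)
    (hlam : 0 < lam) (hnlam : n * lam ≤ 1) (G : Set (EuclideanSpace ℝ (Fin n))) :
    ∃ 𝒞, IsWhitneyFamily (distFun (minimalCubes T)) lam G 𝒞 := by
  have hF := hfin.subset (minimalCubes_subset (T := T))
  have hne := hT.minimalCubes_nonempty hfin hρ
  obtain ⟨ε, hε, hφε⟩ := exists_pos_le_distFun hρ hF hne
  obtain ⟨𝒞, h1, h2, h3⟩ := DyadicCube.exists_whitney (distFun_le_add_dist hρ hF hne) hε hφε hlam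
    hnlam G
  exact ⟨𝒞, h1, h2, fun I hI => (h3 I hI).1, fun I hI x hx => ((h3 I hI).2 x hx).1,
    fun I hI x hx => ((h3 I hI).2 x hx).2⟩

/-- The cubes of a Whitney family stay near the maximal cube. -/
lemma closedCarrier_subset_dilatedBall (hρ : 0 < ρ) (hρ1 : ρ < 1) (hfin : T.Finite)
    (hT : IsStoppingTimeRegion T T₀) (hC₀ : 2 ≤ C₀) (hlam : 0 < lam) (hnlam : n * lam ≤ 1 / 8)
    (h𝒞 : IsWhitneyFamily (distFun (minimalCubes T)) lam (E ∩ T₀.dilatedBall C₀) 𝒞)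
    {I : DyadicCube n} (hI : I ∈ 𝒞) : I.closedCarrier ⊆ T₀.dilatedBall (2 * C₀) := by
  intro x hx
  obtain ⟨y, ⟨hyE, hyB⟩, hyI⟩ := h𝒞.meets I hI
  have hs := T₀.side_pos hρ
  have h1 := h𝒞.side_le I hI y hyI
  have h2 := hT.distFun_le_of_mem hfin hρ hρ1 hyB
  have h3 := DyadicCube.dist_le_of_mem_closedCarrier hx (I.carrier_subset_closedCarrier hyI)
  have h4 : dist y T₀.ctr < C₀ * T₀.side := hyB
  have h5 := dist_triangle x y T₀.ctr
  have h6 : n * I.side ≤ n * (lam * ((C₀ + 2) * T₀.side)) := by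
    gcongr
    exact h1.trans (by gcongr)
  have h7 : n * lam * ((C₀ + 2) * T₀.side) ≤ 1 / 8 * ((C₀ + 2) * T₀.side) := by
    gcongr
  have h8 : 2 * T₀.side ≤ C₀ * T₀.side := by gcongr
  show dist x T₀.ctr < 2 * C₀ * T₀.side
  linarith

/-- Upper regularity of the union of the skeletons of a Whitney family. -/
theorem exists_skeleton_upper (n : ℕ) {ρ : ℝ} (hρ : 0 < ρ) (hρ1 : ρ < 1) (d : ℕ) {a b : ℝ}
    (ha : 0 < a) (hb : 0 < b) {C₀ : ℝ} (hC₀ : 0 < C₀) {lam : ℝ} (hlam : 0 < lam)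
    (hlam1 : lam ≤ 1) :
    ∃ A > 0, ∀ {E : Set (EuclideanSpace ℝ (Fin n))} {D : ChristDavidCubes E ρ} {T : Set D.Cube}
      {T₀ : D.Cube} {w : D.Cube → ℝ} {𝒞 : Set (DyadicCube n)},
      IsStoppingTimeRegion T T₀ → T.Finite → IsRegularWeight d a b T w →
      IsWhitneyFamily (distFun (minimalCubes T)) lam (E ∩ T₀.dilatedBall C₀) 𝒞 →
      𝒞.Finite ∧ ∀ (x : EuclideanSpace ℝ (Fin n)) (r : ℝ), 0 < r →
        μH[(d : ℝ)] ((⋃ I ∈ 𝒞, I.skeleton d) ∩ Metric.ball x r) ≤ ENNReal.ofReal (A * r ^ d) := by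
  classical
  set M : ℝ := C₀ + 3 + 1 / ρ with hM
  have hM0 : 0 < M := by positivity
  obtain ⟨C₆, hC₆, hskel⟩ := DyadicCube.exists_hausdorffMeasure_skeleton_le n d
  obtain ⟨N₁, hN₁⟩ := DyadicCube.exists_card_le n (M * (4 / lam))
  obtain ⟨N₂, hN₂⟩ := DyadicCube.exists_card_le n 1
  obtain ⟨C, hC, hpack⟩ := exists_far_packing_ball n hρ hρ1 d ha hb hM0
    (L := M + (n + 1)) (by positivity)
  refine ⟨N₂ * C₆ + C₆ * (n + 1) ^ d * (N₁ * M ^ d * (C * (4 / lam) ^ d)) + 1, by positivity, ?_⟩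
  intro E D T T₀ w 𝒞 hT hfin hw h𝒞
  have hex : ∀ I : DyadicCube n, ∃ (Q : D.Cube) (y : EuclideanSpace ℝ (Fin n)), I ∈ 𝒞 →
      Q ∈ T ∧ y ∈ E ∧ y ∈ I.carrier ∧ Q.side ≤ distFun (minimalCubes T) y ∧
      distFun (minimalCubes T) y ≤ M * Q.side ∧ dist y Q.ctr ≤ M * Q.side := by
    intro I
    by_cases hI : I ∈ 𝒞
    · obtain ⟨y, ⟨hyE, hyB⟩, hyI⟩ := h𝒞.meets I hI
      obtain ⟨Q, hQT, h1, h2, h3⟩ := hT.exists_charge hfin hρ hρ1 hC₀ hyB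
      have := Q.side_pos hρ
      exact ⟨Q, y, fun _ => ⟨hQT, hyE, hyI, h1, h2.trans (by rw [hM]; gcongr; norm_num), h3⟩⟩
    · exact ⟨T₀, 0, fun h => absurd h hI⟩
  choose q y hq using hex
  -- Whitney cubes charged to `Q` are disjoint, have side at least (lam/4) ℓ(Q) and lie within a
  -- multiple of ℓ(Q) of its center.
  have hfib : ∀ Q : D.Cube, {I | I ∈ 𝒞 ∧ q I = Q}.Finite ∧ {I | I ∈ 𝒞 ∧ q I = Q}.ncard ≤ N₁ := by
    intro Q
    have hs := Q.side_pos hρ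
    refine hN₁ (lam / 4 * Q.side) (by positivity) Q.ctr _
      (h𝒞.disjoint.subset fun I hI => hI.1) fun I hI => ?_
    obtain ⟨-, -, hyI, h1, -, h3⟩ := hq I hI.1
    rw [hI.2] at h1 h3
    refine ⟨?_, y I, I.carrier_subset_closedCarrier hyI, ?_⟩
    · have h4 := h𝒞.le_side I hI.1 _ hyI
      have h5 : lam * Q.side ≤ lam * distFun (minimalCubes T) (y I) := by gcongr
      linarith
    · refine h3.trans (le_of_eq ?_)
      field_simp
  have h𝒞fin : 𝒞.Finite := by
    refine (Set.Finite.biUnion hfin fun Q _ => (hfib Q).1).subset fun I hI => ?_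
    simp only [Set.mem_iUnion]
    exact ⟨q I, (hq I hI).1, hI, rfl⟩
  refine ⟨h𝒞fin, fun x r hr => ?_⟩
  set S := h𝒞fin.toFinset.filter fun I => (I.skeleton d ∩ Metric.ball x r).Nonempty with hS
  have hSm : ∀ I ∈ S, I ∈ 𝒞 ∧ ∃ p ∈ I.closedCarrier, dist p x < r := by
    intro I hI
    rw [hS, Finset.mem_filter, h𝒞fin.mem_toFinset] at hI
    obtain ⟨hI, p, hp, hpx⟩ := hI
    exact ⟨hI, p, I.skeleton_subset_closedCarrier d hp, hpx⟩
  have hcov : (⋃ I ∈ 𝒞, I.skeleton d) ∩ Metric.ball x r ⊆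
      ⋃ I ∈ S, (I.skeleton d ∩ Metric.ball x r) := by
    rintro z ⟨hz, hzx⟩
    simp only [Set.mem_iUnion] at hz ⊢
    obtain ⟨I, hI, hzI⟩ := hz
    exact ⟨I, Finset.mem_filter.2 ⟨h𝒞fin.mem_toFinset.2 hI, z, hzI, hzx⟩, hzI, hzx⟩
  have hterm : ∀ I ∈ S, μH[(d : ℝ)] (I.skeleton d ∩ Metric.ball x r) ≤
      ENNReal.ofReal (if r ≤ I.side then C₆ * r ^ d else C₆ * ((n + 1) * I.side) ^ d) := by
    intro I hI
    split_ifs with h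
    · exact hskel I x r hr.le
    · obtain ⟨-, p, hp, -⟩ := hSm I hI
      have hs := I.side_pos
      refine le_trans (MeasureTheory.measure_mono ?_) (hskel I p ((n + 1) * I.side) (by positivity))
      rintro z ⟨hz, -⟩
      refine ⟨hz, ?_⟩
      have := DyadicCube.dist_le_of_mem_closedCarrier (I.skeleton_subset_closedCarrier d hz) hp
      rw [Metric.mem_ball]
      linarith
  refine (MeasureTheory.measure_mono hcov).trans ((MeasureTheory.measure_biUnion_finset_le _ _).trans
    ((Finset.sum_le_sum hterm).trans ?_))
  rw [← ENNReal.ofReal_sum_of_nonneg (fun I _ => by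
    have := I.side_pos
    split_ifs <;> positivity)]
  refine ENNReal.ofReal_le_ofReal ?_
  -- Whitney cubes of side at least `r` meeting the ball are boundedly many and contribute r^d each;
  -- the smaller ones are summed through the cubes they are charged to.
  rw [Finset.sum_ite]
  have hbig : ∑ I ∈ S with r ≤ I.side, C₆ * r ^ d ≤ N₂ * C₆ * r ^ d := by
    have h1 := hN₂ r hr x (S.filter fun I => r ≤ I.side)
      (h𝒞.disjoint.subset fun I hI => (hSm I (Finset.mem_filter.1 hI).1).1) fun I hI => by
        obtain ⟨hIS, hIr⟩ := Finset.mem_filter.1 hI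
        obtain ⟨-, p, hp, hpx⟩ := hSm I hIS
        exact ⟨hIr, p, hp, by linarith⟩
    rw [Set.ncard_coe_finset] at h1
    rw [Finset.sum_const, nsmul_eq_mul, ← mul_assoc]
    gcongr
    exact h1.2
  have hsmall : ∑ I ∈ S with ¬ r ≤ I.side, I.side ^ d ≤
      N₁ * M ^ d * (C * (4 / lam) ^ d) * r ^ d := by
    set S' := S.filter fun I => ¬ r ≤ I.side with hS'
    set A := S'.image q with hA
    have hS'm : ∀ I ∈ S', I ∈ 𝒞 := fun I hI => (hSm I (Finset.mem_filter.1 hI).1).1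
    have h1 := sum_le_sum_sum_filter S' A (fun Q I => q I = Q) (f := fun I => I.side ^ d)
      (fun I _ => pow_nonneg I.side_pos.le d) fun I hI => ⟨q I, Finset.mem_image_of_mem q hI, rfl⟩
    have h2 : ∀ Q ∈ A, ∑ I ∈ S' with q I = Q, I.side ^ d ≤ N₁ * M ^ d * Q.side ^ d := by
      intro Q _
      have hcard : (S'.filter fun I => q I = Q).card ≤ N₁ := by
        rw [← Set.ncard_coe_finset]
        refine (Set.ncard_le_ncard ?_ (hfib Q).1).trans (hfib Q).2
        intro I hI
        obtain ⟨hI1, hI2⟩ := Finset.mem_filter.1 hI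
        exact ⟨hS'm I hI1, hI2⟩
      have hs := Q.side_pos hρ
      refine (Finset.sum_le_card_nsmul _ _ ((M * Q.side) ^ d) fun I hI => ?_).trans ?_
      · obtain ⟨hI1, hI2⟩ := Finset.mem_filter.1 hI
        obtain ⟨-, -, hyI, h0, h3, -⟩ := hq I (hS'm I hI1)
        rw [hI2] at h0 h3
        have hφ : 0 ≤ distFun (minimalCubes T) (y I) := hs.le.trans h0
        have h4 := h𝒞.side_le I (hS'm I hI1) _ hyI
        have hsI := I.side_pos
        have h5 : lam * distFun (minimalCubes T) (y I) ≤ 1 * (M * Q.side) := by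
          gcongr
        gcongr
        linarith
      · rw [nsmul_eq_mul, mul_pow, mul_assoc]
        gcongr
    -- A cube charged by a Whitney cube of side below `r` has side at most (4/lam) r, which is
    -- therefore the radius for packing in balls.
    have h3 : ∑ Q ∈ A, Q.side ^ d ≤ C * (4 / lam * r) ^ d := by
      refine hpack hT hfin hw x (4 / lam * r) (by positivity) A fun Q hQ => ?_
      obtain ⟨I, hI, rfl⟩ := Finset.mem_image.1 hQ
      obtain ⟨hIS, hIr⟩ := Finset.mem_filter.1 hI
      obtain ⟨hI𝒞, p, hp, hpx⟩ := hSm I hIS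
      obtain ⟨hQT, hyE, hyI, h4, h5, h6⟩ := hq I hI𝒞
      have h7 := h𝒞.le_side I hI𝒞 _ hyI
      have h8 : (q I).side ≤ 4 / lam * r := by
        refine h4.trans ?_
        rw [div_mul_eq_mul_div, le_div_iff₀ hlam]
        linarith
      have h9 := DyadicCube.dist_le_of_mem_closedCarrier (I.carrier_subset_closedCarrier hyI) hp
      have h10 := dist_triangle4 (q I).ctr (y I) p x
      rw [dist_comm (q I).ctr (y I)] at h10
      have h11 : M * (q I).side ≤ M * (4 / lam * r) := by gcongr
      have h12 : r ≤ 4 / lam * r := by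
        rw [div_mul_eq_mul_div, le_div_iff₀ hlam]
        nlinarith
      have h13 : n * I.side ≤ n * r := by
        have := (not_le.1 hIr).le
        gcongr
      have h14 : n * r ≤ n * (4 / lam * r) := by gcongr
      exact ⟨hQT, h8, by linarith, y I, hyE, h4, h6⟩
    calc _ ≤ ∑ Q ∈ A, N₁ * M ^ d * Q.side ^ d := h1.trans (Finset.sum_le_sum h2)
      _ = N₁ * M ^ d * ∑ Q ∈ A, Q.side ^ d := by rw [Finset.mul_sum]
      _ ≤ N₁ * M ^ d * (C * (4 / lam * r) ^ d) := by gcongr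
      _ = _ := by rw [mul_pow]; ring
  have hsmall' : ∑ I ∈ S with ¬ r ≤ I.side, C₆ * ((n + 1) * I.side) ^ d ≤
      C₆ * (n + 1) ^ d * (N₁ * M ^ d * (C * (4 / lam) ^ d)) * r ^ d := by
    calc _ = C₆ * (n + 1) ^ d * ∑ I ∈ S with ¬ r ≤ I.side, I.side ^ d := by
          rw [Finset.mul_sum]
          exact Finset.sum_congr rfl fun I _ => by rw [mul_pow, mul_assoc]
      _ ≤ C₆ * (n + 1) ^ d * (N₁ * M ^ d * (C * (4 / lam) ^ d) * r ^ d) := by gcongr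
      _ = _ := by ring
  have hrd : 0 ≤ r ^ d := by positivity
  linarith

end Whitney

end ChristDavidCubes

/-! ### Lower regularity -/

lemma IsLowerContentRegular.dim_le {n d : ℕ} (hd : 0 < d) {c : ℝ} (hc : 0 < c)
    {E : Set (EuclideanSpace ℝ (Fin n))} (hE : IsLowerContentRegular c d E)
    (hdiam : 1 ≤ Metric.ediam E) : d ≤ n := by
  by_contra! hlt
  obtain ⟨x, hx⟩ : E.Nonempty := by
    rw [Set.nonempty_iff_ne_empty]
    rintro rfl
    simp at hdiam
  have h1 := hE x hx (1 / 2) (by norm_num) (lt_of_lt_of_le (by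
    rw [ENNReal.ofReal_lt_one]; norm_num) hdiam)
  -- If `d > n`, H^d vanishes on ℝⁿ, contradicting the positive content of the ball. The bound d ≤ n
  -- ensures that d-faces exist.
  have h2 : dimH (E ∩ Metric.ball x (1 / 2)) < (d : NNReal) := by
    refine (dimH_mono (Set.subset_univ _)).trans_lt ?_
    rw [Real.dimH_univ_eq_finrank, finrank_euclideanSpace, Fintype.card_fin]
    exact_mod_cast hlt
  have h3 := hausdorffMeasure_of_dimH_lt h2
  have h4 := h1.trans (hausdorffContent_le_hausdorffMeasure hd _)
  rw [NNReal.coe_natCast] at h3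
  rw [h3, nonpos_iff_eq_zero, ENNReal.ofReal_eq_zero] at h4
  have : 0 < c * (1 / 2) ^ d := by positivity
  linarith

namespace ChristDavidCubes

/-- Lower regularity of the union of the skeletons of a Whitney family. -/
theorem exists_skeleton_lower (n : ℕ) {ρ : ℝ} (hρ : 0 < ρ) (hρ1 : ρ < 1) {d : ℕ} (hd : 0 < d)
    {c : ℝ} (hc : 0 < c) {C₀ : ℝ} (hC₀ : 2 ≤ C₀) {lam : ℝ} (hlam : 0 < lam) (hlam1 : lam ≤ 1)
    (hnlam : n * lam ≤ 1 / 8) :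
    ∃ A > 0, ∀ {E : Set (EuclideanSpace ℝ (Fin n))} {D : ChristDavidCubes E ρ} {T : Set D.Cube}
      {T₀ : D.Cube} {𝒞 : Set (DyadicCube n)},
      IsLowerContentRegular c d E → 1 ≤ Metric.ediam E → 0 ≤ T₀.gen →
      IsStoppingTimeRegion T T₀ → T.Finite → 𝒞.Finite →
      IsWhitneyFamily (distFun (minimalCubes T)) lam (E ∩ T₀.dilatedBall C₀) 𝒞 →
      ∀ x ∈ ⋃ I ∈ 𝒞, I.skeleton d, ∀ r : ℝ, 0 < r → r ≤ 4 * C₀ * T₀.side →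
        ENNReal.ofReal (r ^ d / A) ≤ μH[(d : ℝ)] ((⋃ I ∈ 𝒞, I.skeleton d) ∩ Metric.ball x r) := by
  classical
  -- If ℓ(I₀) < r/M, the first term gives φ(y) ≤ r/(40 C₀) for `y` in `I₀`, and the second bounds
  -- the diameter of `I₀` by r/16.
  set M : ℝ := 160 * C₀ / lam + 16 * n with hM
  have hM1 : 1 ≤ M := by
    have : 160 * C₀ ≤ 160 * C₀ / lam := le_div_self (by linarith) hlam hlam1
    have : (0 : ℝ) ≤ n := Nat.cast_nonneg n
    linarith
  have hM0 : 0 < M := by linarith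
  refine ⟨(M * (2 * (n + 1))) ^ d + (40 * C₀ * (2 * (n + 1))) ^ d / c, by positivity, ?_⟩
  intro E D T T₀ 𝒞 hE hdiam hgen hT hfin h𝒞fin h𝒞 x hx r hr hrT
  simp only [Set.mem_iUnion] at hx
  obtain ⟨I₀, hI₀, hxI₀⟩ := hx
  have hA₁ : 0 < (M * (2 * (n + 1) : ℝ)) ^ d := by positivity
  have hA₂ : 0 < (40 * C₀ * (2 * (n + 1) : ℝ)) ^ d / c := by positivity
  rcases le_or_gt (r / M) I₀.side with hcase | hcase
  · calc ENNReal.ofReal (r ^ d / _) ≤ ENNReal.ofReal (r ^ d / (M * (2 * (n + 1))) ^ d) := by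
          gcongr; linarith
      _ = ENNReal.ofReal ((r / M / (2 * (n + 1))) ^ d) := by rw [← div_pow, div_div]
      _ ≤ μH[(d : ℝ)] (I₀.skeleton d ∩ Metric.ball x (r / M)) :=
          DyadicCube.le_hausdorffMeasure_skeleton hxI₀ (by positivity) hcase
      _ ≤ _ := by
          refine MeasureTheory.measure_mono (Set.inter_subset_inter ?_
            (Metric.ball_subset_ball (div_le_self hr.le hM1)))
          exact Set.subset_biUnion_of_mem (u := fun I : DyadicCube n => I.skeleton d) hI₀
  obtain ⟨y, ⟨hyE, hyB⟩, hyI₀⟩ := h𝒞.meets I₀ hI₀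
  have hF := hfin.subset (minimalCubes_subset (T := T))
  have hFne := hT.minimalCubes_nonempty hfin hρ
  obtain ⟨Q, hQ, hQe⟩ := exists_distFun_eq hF hFne y
  set φ := distFun (minimalCubes T) with hφ
  -- As r ≤ 4C₀ℓ(T₀), `t` is at most ℓ(T₀)/10 ≤ 1/2 < diam `E`, so content regularity applies at the
  -- center of `Q` and the ball stays in C₀B_T; also 80t ≤ r, since C₀ ≥ 2.
  set t : ℝ := r / (40 * C₀) with ht
  have ht0 : 0 < t := by positivity
  have htr : t * (40 * C₀) = r := by rw [ht]; field_simp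
  have hI₀r : I₀.side * M < r := (lt_div_iff₀ hM0).1 hcase
  have hI₀s := I₀.side_pos
  have hφy : φ y ≤ t := by
    have h1 := h𝒞.le_side I₀ hI₀ y hyI₀
    have h2 : 160 * C₀ / lam * I₀.side ≤ r := by
      have : (0 : ℝ) ≤ 16 * n * I₀.side := by positivity
      rw [hM] at hI₀r
      linarith
    rw [div_mul_eq_mul_div, div_le_iff₀ hlam] at h2
    have h3 : 40 * C₀ * (lam * φ y) ≤ 40 * C₀ * (4 * I₀.side) := by gcongr
    have h4 : (40 * C₀ * lam) * φ y ≤ (40 * C₀ * lam) * t := by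
      calc _ = 40 * C₀ * (lam * φ y) := by ring
        _ ≤ r * lam := by linarith
        _ = _ := by rw [← htr]; ring
    exact le_of_mul_le_mul_left h4 (by positivity)
  have hnI₀ : n * I₀.side ≤ r / 16 := by
    have : 0 ≤ 160 * C₀ / lam * I₀.side := by positivity
    rw [hM] at hI₀r
    linarith
  have hyQ : dist y Q.ctr ≤ t := by
    have := Q.dist_ctr_le_infDist hρ y
    linarith
  have hxy := DyadicCube.dist_le_of_mem_closedCarrier (I₀.skeleton_subset_closedCarrier d hxI₀)
    (I₀.carrier_subset_closedCarrier hyI₀)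
  have hT₀s := T₀.side_pos hρ
  have htT₀ : t ≤ T₀.side / 10 := by
    rw [ht, div_le_iff₀ (by positivity)]
    linarith
  have h80 : 80 * t ≤ r := by
    rw [← htr]; nlinarith
  have hT₀5 := Cube.side_le_five hρ hρ1 hgen
  have hcont := hE Q.ctr Q.ctr_mem_ambient t ht0 (lt_of_lt_of_le (by
    rw [ENNReal.ofReal_lt_one]; linarith) hdiam)
  have hQT₀ := Cube.dist_ctr_lt_of_le hρ (hT.greatest.2 hQ.1)
  set S := h𝒞fin.toFinset.filter fun I => ∃ z ∈ I.carrier, dist z Q.ctr < t with hS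
  have hcov : E ∩ Metric.ball Q.ctr t ⊆ ⋃ I ∈ S, I.carrier := by
    rintro z ⟨hzE, hzQ⟩
    have hzB : z ∈ T₀.dilatedBall C₀ := by
      have h1 := dist_triangle z Q.ctr T₀.ctr
      have h2 : 2 * T₀.side ≤ C₀ * T₀.side := by gcongr
      have h3 := Metric.mem_ball.1 hzQ
      show dist z T₀.ctr < C₀ * T₀.side
      linarith
    have h1 := h𝒞.cover ⟨hzE, hzB⟩
    simp only [Set.mem_iUnion] at h1 ⊢
    obtain ⟨I, hI, hzI⟩ := h1
    exact ⟨I, Finset.mem_filter.2 ⟨h𝒞fin.mem_toFinset.2 hI, z, hzI, hzQ⟩, hzI⟩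
  -- The Lipschitz bound gives φ ≤ 3t at points of the small ball, so these Whitney cubes have
  -- diameter at most 3t/8 and cannot leave B(x, r).
  have hSm : ∀ I ∈ S, I ∈ 𝒞 ∧ I.closedCarrier ⊆ Metric.ball x r := by
    intro I hI
    rw [hS, Finset.mem_filter, h𝒞fin.mem_toFinset] at hI
    obtain ⟨hI, z, hzI, hzQ⟩ := hI
    refine ⟨hI, fun p hp => ?_⟩
    have h1 := distFun_le_add_dist hρ hF hFne z y
    have h2 := dist_triangle_right z y Q.ctr
    have h3 := h𝒞.side_le I hI z hzI
    have h4 := DyadicCube.dist_le_of_mem_closedCarrier hp (I.carrier_subset_closedCarrier hzI)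
    have h5 : n * I.side ≤ n * (lam * (3 * t)) := by
      gcongr
      refine h3.trans ?_
      gcongr
      linarith
    have h6 : n * lam * (3 * t) ≤ 1 / 8 * (3 * t) := by gcongr
    have h7 := dist_triangle4 p z Q.ctr y
    have h8 := dist_triangle p y x
    rw [dist_comm Q.ctr y] at h7
    rw [dist_comm y x] at h8
    rw [Metric.mem_ball]
    linarith
  obtain ⟨s, -, hs⟩ := Finset.exists_subset_card_eq (s := (Finset.univ : Finset (Fin n))) (n := d)
    (by simpa using hE.dim_le hd hc hdiam)
  have hmeas : ∑ I ∈ S, ENNReal.ofReal (I.side ^ d) ≤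
      μH[(d : ℝ)] ((⋃ I ∈ 𝒞, I.skeleton d) ∩ Metric.ball x r) := by
    calc _ ≤ ∑ I ∈ S, μH[(d : ℝ)] (I.lowerFace s) := by
          refine Finset.sum_le_sum fun I _ => ?_
          have := DyadicCube.le_hausdorffMeasure_lowerFace s I
          rwa [hs] at this
      -- Half-open lower faces with one fixed set of directions lie in the disjoint half-open cubes,
      -- so their measures add; closed skeletons could overlap.
      _ = μH[(d : ℝ)] (⋃ I ∈ S, I.lowerFace s) := by
          refine (MeasureTheory.measure_biUnion_finset ?_
            fun I _ => DyadicCube.measurableSet_lowerFace s I).symm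
          intro I hI J hJ hne
          exact (h𝒞.disjoint (hSm I hI).1 (hSm J hJ).1 hne).mono (fun _ h => h.1) fun _ h => h.1
      _ ≤ _ := by
          refine MeasureTheory.measure_mono (Set.iUnion₂_subset fun I hI z hz => ⟨?_, ?_⟩)
          · simp only [Set.mem_iUnion]
            exact ⟨I, (hSm I hI).1, hs ▸ I.lowerFace_subset_skeleton s hz⟩
          · exact (hSm I hI).2 (I.carrier_subset_closedCarrier hz.1)
  -- Content regularity is tested against the cover of the small ball by Whitney cubes, each inside
  -- a ball of radius (n+1) ℓ(I).
  have hsum : c * t ^ d ≤ (2 * (n + 1)) ^ d * ∑ I ∈ S, I.side ^ d := by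
    have hnn : 0 ≤ (2 * (n + 1) : ℝ) ^ d * ∑ I ∈ S, I.side ^ d :=
      mul_nonneg (by positivity) (Finset.sum_nonneg fun I _ => pow_nonneg I.side_pos.le d)
    rw [← ENNReal.ofReal_le_ofReal_iff hnn]
    refine hcont.trans ((hausdorffContent_le_sum hd _ _ hcov).trans ?_)
    rw [Finset.mul_sum, ENNReal.ofReal_sum_of_nonneg fun I _ =>
      mul_nonneg (by positivity) (pow_nonneg I.side_pos.le d)]
    refine Finset.sum_le_sum fun I hI => ?_
    obtain ⟨-, z, hzI, -⟩ := Finset.mem_filter.1 hI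
    have hIs := I.side_pos
    rw [← mul_pow, mul_assoc]
    refine hausdorffContent_le_of_subset_ball hd (x := z) (by positivity) fun p hp => ?_
    have := DyadicCube.dist_le_of_mem_closedCarrier (I.carrier_subset_closedCarrier hp)
      (I.carrier_subset_closedCarrier hzI)
    rw [Metric.mem_ball]
    linarith
  refine le_trans ?_ hmeas
  rw [← ENNReal.ofReal_sum_of_nonneg fun I _ => pow_nonneg I.side_pos.le d]
  refine ENNReal.ofReal_le_ofReal ?_
  calc r ^ d / _ ≤ r ^ d / ((40 * C₀ * (2 * (n + 1))) ^ d / c) := by gcongr; linarith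
    _ ≤ _ := by
      rw [div_le_iff₀ hA₂, ← htr, mul_pow t, mul_pow (40 * C₀) (2 * ((n : ℝ) + 1))]
      rw [← mul_div_assoc, le_div_iff₀ hc]
      have h1 : (40 * C₀) ^ d * (c * t ^ d) ≤
          (40 * C₀) ^ d * ((2 * (n + 1)) ^ d * ∑ I ∈ S, I.side ^ d) := by gcongr
      linarith

/-- Every region with a regular weight is approximated by an Ahlfors regular union of skeletons of
dyadic cubes. -/
theorem exists_ahlforsRegular_whitney (n : ℕ) {ρ : ℝ} (hρ : 0 < ρ) (hρ1 : ρ < 1) {d : ℕ}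
    (hd : 0 < d) {c : ℝ} (hc : 0 < c) {a b : ℝ} (ha : 0 < a) (hb : 0 < b) {C₀ : ℝ} (hC₀ : 2 ≤ C₀)
    {lam : ℝ} (hlam : 0 < lam) (hlam1 : lam ≤ 1) (hnlam : n * lam ≤ 1 / 8) :
    ∃ A : ℝ, ∀ {E : Set (EuclideanSpace ℝ (Fin n))} {D : ChristDavidCubes E ρ} {T : Set D.Cube}
      {T₀ : D.Cube} {w : D.Cube → ℝ} {𝒞 : Set (DyadicCube n)},
      IsLowerContentRegular c d E → 1 ≤ Metric.ediam E → 0 ≤ T₀.gen →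
      IsStoppingTimeRegion T T₀ → T.Finite → IsRegularWeight d a b T w →
      IsWhitneyFamily (distFun (minimalCubes T)) lam (E ∩ T₀.dilatedBall C₀) 𝒞 →
      IsAhlforsRegular d A (⋃ I ∈ 𝒞, I.skeleton d) := by
  obtain ⟨A₁, hA₁, hup⟩ := exists_skeleton_upper n hρ hρ1 d ha hb (by linarith : 0 < C₀) hlam hlam1
  obtain ⟨A₂, hA₂, hlow⟩ := exists_skeleton_lower n hρ hρ1 hd hc hC₀ hlam hlam1 hnlam
  refine ⟨A₁ + A₂, ?_⟩
  intro E D T T₀ w 𝒞 hE hdiam hgen hT hfin hw h𝒞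
  obtain ⟨h𝒞fin, hup⟩ := hup hT hfin hw h𝒞
  refine ⟨by positivity, fun x hx r hr hrS => ⟨?_, ?_⟩⟩
  · have hs := T₀.side_pos hρ
    -- The union of skeletons lies in 2C₀B_T, so radii below its diameter fall in the range of the
    -- lower bound.
    have hrT : r ≤ 4 * C₀ * T₀.side := by
      have hsub : (⋃ I ∈ 𝒞, I.skeleton d) ⊆ Metric.ball T₀.ctr (2 * C₀ * T₀.side) :=
        Set.iUnion₂_subset fun I hI => (I.skeleton_subset_closedCarrier d).trans
          (closedCarrier_subset_dilatedBall hρ hρ1 hfin hT hC₀ hlam hnlam h𝒞 hI)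
      have h1 : Metric.ediam (⋃ I ∈ 𝒞, I.skeleton d) ≤ ENNReal.ofReal (4 * C₀ * T₀.side) := by
        refine Metric.ediam_le fun p hp q hq => ?_
        rw [edist_dist]
        refine ENNReal.ofReal_le_ofReal ?_
        have h2 := Metric.mem_ball.1 (hsub hp)
        have h3 := Metric.mem_ball.1 (hsub hq)
        have h4 := dist_triangle_right p q T₀.ctr
        linarith
      exact (ENNReal.ofReal_le_ofReal_iff (by positivity)).1 (hrS.le.trans h1)
    refine le_trans (ENNReal.ofReal_le_ofReal ?_)
      (hlow hE hdiam hgen hT hfin h𝒞fin h𝒞 x hx r hr hrT)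
    gcongr
    linarith
  · refine (hup x r hr).trans (ENNReal.ofReal_le_ofReal ?_)
    gcongr
    linarith

end ChristDavidCubes

/-! ### Assembly of the main theorem -/

theorem mainTheorem1 (n : ℕ) (ρ : ℝ) (hρ₀ : 0 < ρ) (hρ₁ : ρ < 1 / 1000) :
    -- `K` depends on `n, ρ` only
    ∃ K : ℝ, 0 < K ∧
    ∀ (d : ℕ) (c : ℝ), 0 < d → 0 < c →
    -- `K₁` and the function `A` of `C₀, τ` depend on `n, ρ, d, c` only
    ∃ (K₁ : ℝ) (A : ℝ → ℝ → ℝ), 0 < K₁ ∧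
    ∀ E : Set (EuclideanSpace ℝ (Fin n)),
      IsLowerContentRegular c d E → 1 ≤ Metric.ediam E →
    ∀ (D : ChristDavidCubes E ρ) (Q₀ : D.Cube), Q₀.gen = 0 →
    ∀ k₀ : ℕ,
    ∃ (Top : Set D.Cube) (Tree : D.Cube → Set D.Cube),
      -- the trees partition the cubes of generations `0, …, k₀` in `Q₀`
      Top ⊆ ChristDavidCubes.upTo Q₀ k₀ ∧
      (∀ R ∈ Top, ChristDavidCubes.IsStoppingTimeRegion (Tree R) R) ∧
      Top.PairwiseDisjoint Tree ∧
      (⋃ R ∈ Top, Tree R) = ChristDavidCubes.upTo Q₀ k₀ ∧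
      -- packing of the top cubes
      (∑' R : Top, ENNReal.ofReal ((R : D.Cube).side ^ d)
        ≤ ENNReal.ofReal K₁ * μH[(d : ℝ)] Q₀.carrier) ∧
      -- approximation of `E` by an Ahlfors regular set in every stopping-time region
      ∀ R ∈ Top, ∀ (T : Set D.Cube) (T₀ : D.Cube), T ⊆ Tree R →
        ChristDavidCubes.IsStoppingTimeRegion T T₀ →
      ∀ C₀ τ : ℝ, 4 < C₀ → 0 < τ → τ < 1 →
      ∃ 𝒞 : Set (DyadicCube n),
        𝒞.PairwiseDisjoint DyadicCube.carrier ∧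
        IsAhlforsRegular d (A C₀ τ) (⋃ I ∈ 𝒞, I.skeleton d) ∧
        T₀.dilatedBall C₀ ∩ E ⊆ (⋃ I ∈ 𝒞, I.carrier) ∧
        (⋃ I ∈ 𝒞, I.carrier) ⊆ T₀.dilatedBall (2 * C₀) ∧
        (∀ x ∈ E ∩ T₀.dilatedBall C₀,
          Metric.infDist x (⋃ I ∈ 𝒞, I.skeleton d)
            ≤ K * (τ * ChristDavidCubes.distFun (ChristDavidCubes.minimalCubes T) x)) ∧
        ∀ I ∈ 𝒞,
          τ * (⨅ x : I.carrier,
            ChristDavidCubes.distFun (ChristDavidCubes.minimalCubes T) x) ≤ K * I.side ∧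
          I.side ≤ K * (τ * ⨅ x : I.carrier,
            ChristDavidCubes.distFun (ChristDavidCubes.minimalCubes T) x) := by
  have hρ1 : ρ < 1 := by linarith
  have hn : (0 : ℝ) ≤ n := Nat.cast_nonneg n
  refine ⟨32 * (n + 1), by positivity, fun d c hd hc => ?_⟩
  have ha : 0 < c / 500 ^ d / 2 := by positivity
  have hb : (0 : ℝ) < 2 ^ d := by positivity
  -- The Whitney factor τ/(8(n+1)) keeps Whitney cubes inside 2C₀B_T; `K = 32(n+1)` absorbs its
  -- denominator and the Whitney constant 4.
  have hlam : ∀ τ : ℝ, 0 < τ → τ < 1 →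
      0 < τ / (8 * (n + 1)) ∧ τ / (8 * (n + 1)) ≤ 1 ∧ n * (τ / (8 * (n + 1))) ≤ 1 / 8 := by
    intro τ hτ hτ1
    refine ⟨by positivity, ?_, ?_⟩
    · rw [div_le_one (by positivity)]; linarith
    · rw [← mul_div_assoc, div_le_iff₀ (by positivity)]
      nlinarith
  -- The regularity constant is fixed before the set, the cubes and the region are given. Outside
  -- the admissible parameters its value is irrelevant and taken to be 0.
  have hex : ∀ C₀ τ : ℝ, ∃ A : ℝ, 4 < C₀ → 0 < τ → τ < 1 →
      ∀ {E : Set (EuclideanSpace ℝ (Fin n))} {D : ChristDavidCubes E ρ} {T : Set D.Cube}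
        {T₀ : D.Cube} {w : D.Cube → ℝ} {𝒞 : Set (DyadicCube n)},
        IsLowerContentRegular c d E → 1 ≤ Metric.ediam E → 0 ≤ T₀.gen →
        ChristDavidCubes.IsStoppingTimeRegion T T₀ → T.Finite →
        ChristDavidCubes.IsRegularWeight d (c / 500 ^ d / 2) (2 ^ d) T w →
        IsWhitneyFamily (ChristDavidCubes.distFun (ChristDavidCubes.minimalCubes T))
          (τ / (8 * (n + 1))) (E ∩ T₀.dilatedBall C₀) 𝒞 →
        IsAhlforsRegular d A (⋃ I ∈ 𝒞, I.skeleton d) := by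
    intro C₀ τ
    by_cases h : 4 < C₀ ∧ 0 < τ ∧ τ < 1
    · obtain ⟨hC₀, hτ, hτ1⟩ := h
      obtain ⟨h1, h2, h3⟩ := hlam τ hτ hτ1
      obtain ⟨A, hA⟩ := ChristDavidCubes.exists_ahlforsRegular_whitney n hρ₀ hρ1 hd hc ha hb
        (by linarith : 2 ≤ C₀) h1 h2 h3
      exact ⟨A, fun _ _ _ => hA⟩
    · exact ⟨0, fun h1 h2 h3 => absurd ⟨h1, h2, h3⟩ h⟩
  choose A hA using hex
  refine ⟨4 * (500 ^ d / c), A, by positivity, fun E hE hdiam D Q₀ hQ₀ k₀ => ?_⟩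
  obtain ⟨Top, Tree, hTop, hTree, hdisj, hunion, hpack, hweight⟩ :=
    ChristDavidCubes.exists_corona hρ₀ hρ1 hd hc hE hdiam hQ₀ k₀
  refine ⟨Top, Tree, hTop, hTree, hdisj, hunion, hpack, ?_⟩
  intro R hR T T₀ hTR hT C₀ τ hC₀ hτ hτ1
  obtain ⟨w, hw⟩ := hweight R hR
  obtain ⟨hl0, hl1, hln⟩ := hlam τ hτ hτ1
  have hTup : T ⊆ ChristDavidCubes.upTo Q₀ k₀ := by
    rw [← hunion]
    exact hTR.trans (Set.subset_biUnion_of_mem hR)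
  have hfin : T.Finite := (ChristDavidCubes.finite_upTo hρ₀ Q₀ k₀).subset hTup
  have hgen : 0 ≤ T₀.gen := (hTup hT.greatest.1).1
  obtain ⟨𝒞, h𝒞⟩ := ChristDavidCubes.exists_whitneyFamily hρ₀ hfin hT hl0 (by linarith)
    (E ∩ T₀.dilatedBall C₀)
  have hFne := hT.minimalCubes_nonempty hfin hρ₀
  have hF := hfin.subset (ChristDavidCubes.minimalCubes_subset (T := T))
  obtain ⟨ε, hε, hφε⟩ := ChristDavidCubes.exists_pos_le_distFun hρ₀ hF hFne
  refine ⟨𝒞, h𝒞.disjoint, hA C₀ τ hC₀ hτ hτ1 hE hdiam hgen hT hfin (hw.mono hTR) h𝒞, ?_, ?_, ?_, ?_⟩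
  · rw [Set.inter_comm]; exact h𝒞.cover
  · exact Set.iUnion₂_subset fun I hI => I.carrier_subset_closedCarrier.trans
      (ChristDavidCubes.closedCarrier_subset_dilatedBall hρ₀ hρ1 hfin hT (by linarith) hl0 hln
        h𝒞 hI)
  · intro x hx
    have h1 := h𝒞.cover hx
    simp only [Set.mem_iUnion] at h1
    obtain ⟨I, hI, hxI⟩ := h1
    have hIs := I.side_pos
    obtain ⟨s, -, hs⟩ := Finset.exists_subset_card_eq (s := (Finset.univ : Finset (Fin n)))
      (n := d) (by simpa using hE.dim_le hd hc hdiam)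
    -- The lower corner of the Whitney cube through `x` is a skeleton point at distance at most n
    -- ℓ(I).
    have hp : WithLp.toLp 2 (fun i => I.index i * I.side) ∈ I.skeleton d :=
      ⟨s, hs, fun i _ => ⟨le_rfl, by dsimp only; linarith⟩, fun i _ => Or.inl rfl⟩
    have h2 := DyadicCube.dist_le_of_mem_closedCarrier (I.carrier_subset_closedCarrier hxI)
      (I.skeleton_subset_closedCarrier d hp)
    have h3 := h𝒞.side_le I hI x hxI
    have h4 : WithLp.toLp 2 (fun i => I.index i * I.side) ∈ ⋃ I ∈ 𝒞, I.skeleton d := by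
      simp only [Set.mem_iUnion]
      exact ⟨I, hI, hp⟩
    refine (Metric.infDist_le_dist_of_mem h4).trans (h2.trans ?_)
    set φ := ChristDavidCubes.distFun (ChristDavidCubes.minimalCubes T) x with hφ
    have hφ0 : 0 ≤ τ * φ := mul_nonneg hτ.le (hε.le.trans (hφε x))
    have h5 : τ / (8 * (n + 1)) * φ ≤ τ * φ := by
      have : 0 ≤ φ := hε.le.trans (hφε x)
      gcongr
      exact div_le_self hτ.le (by linarith)
    calc n * I.side ≤ 32 * (n + 1) * I.side := by gcongr; linarith
      _ ≤ _ := by gcongr; exact h3.trans h5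
  · intro I hI
    have hIs := I.side_pos
    obtain ⟨y, -, hyI⟩ := h𝒞.meets I hI
    -- Needed, along with nonemptiness of the cube, for the real infimum to be a genuine one.
    have hbdd : BddBelow (Set.range fun x : I.carrier =>
        ChristDavidCubes.distFun (ChristDavidCubes.minimalCubes T) (x : EuclideanSpace ℝ (Fin n))) :=
      ⟨ε, by rintro _ ⟨x, rfl⟩; exact hφε x⟩
    have : Nonempty I.carrier := ⟨⟨y, hyI⟩⟩
    have hn8 : (0 : ℝ) < 8 * (n + 1) := by positivity
    constructor
    · have h1 := ciInf_le hbdd ⟨y, hyI⟩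
      have h2 := h𝒞.le_side I hI y hyI
      rw [div_mul_eq_mul_div, div_le_iff₀ hn8] at h2
      calc _ ≤ τ * ChristDavidCubes.distFun (ChristDavidCubes.minimalCubes T) y := by gcongr
        _ ≤ _ := by linarith
    · have h1 : I.side * (8 * (n + 1)) / τ ≤ ⨅ x : I.carrier,
          ChristDavidCubes.distFun (ChristDavidCubes.minimalCubes T)
            (x : EuclideanSpace ℝ (Fin n)) := by
        refine le_ciInf fun x => ?_
        have h2 := h𝒞.side_le I hI x x.2
        rw [div_mul_eq_mul_div, le_div_iff₀ hn8] at h2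
        rw [div_le_iff₀ hτ]
        linarith
      rw [div_le_iff₀ hτ] at h1
      have h3 : 1 * I.side ≤ 32 * (n + 1) * (8 * (n + 1)) * I.side := by
        gcongr
        nlinarith
      calc I.side ≤ 32 * (n + 1) * (I.side * (8 * (n + 1))) := by linarith
        _ ≤ _ := by
          rw [mul_comm τ]
          gcongr
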